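/- **Setting.** For each $m$, let $(\nu_i,X_i)$, $1\le i\le m$, be i.i.d. from the two-groups model with $\sigma^2=1$: $\nu_i\sim\mathrm{Bernoulli}(p)$, $X_i\mid\nu_i=0\sim N(0,1)$ and $X_i\mid\nu_i=1\sim N(0,1+\psi^2)$, where $p=p_m\in(0,1)$ and $\psi^2=\psi_m^2>0$. One tests $H_{0i}:\nu_i=0$ against $H_{1i}:\nu_i=1$ for $i=1,\dots,m$, and the Bayes risk of a multiple testing rule is its expected number of misclassified hypotheses. The Bayes Oracle is the rule which rejects $H_{0i}$ iff $f(X_i\mid\nu_i=1)/f(X_i\mid\nu_i=0)>(1-p)/p$, where $f(\cdot\mid\nu_i)$ is the conditional density of $X_i$; its Bayes risk is denoted $R^{BO}_{Opt}$. Assume that, as $m\to\infty$, $$p\to0,\qquad \psi^2\to\infty,\qquad v:=\psi^2\Big(\frac{1-p}{p}\Big)^2\to\infty,\qquad \frac{\log v}{\psi^2}\to C\in(0,\infty).$$ Let $\tau=\tau_m>0$ satisfy $\tau\to0$ and $\lim_{m\to\infty}\tau/p\in(0,\infty)$. Consider the one-group prior under which, independently for $i=1,\dots,m$, $X_i\mid\mu_i\sim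 N(\mu_i,1)$, $\mu_i\mid\lambda_i^2\sim N(0,\lambda_i^2\tau^2)$, and $\lambda_i^2$ has the proper (that is, probability) density $\pi(\lambda_i^2)=K(\lambda_i^2)^{-a-1}L(\lambda_i^2)$ on $(0,\infty)$, where $K>0$ is a constant and $L:(0,\infty)\to(0,\infty)$ is measurable and slowly varying, i.e. $L(\alpha x)/L(x)\to1$ as $x\to\infty$ for every $\alpha>0$. ($K$, $a$ and $L$ do not depend on $m$.) Put $\kappa_i=1/(1+\lambda_i^2\tau^2)$, and let $R_{OG}$ be the Bayes risk, under the two-groups model, of the rule "reject $H_{0i}$ if $1-E(\kappa_i\mid X_i,\tau)>1/2$", where $E(\cdot\mid X_i,\tau)$ is the posterior expectation under the one-group prior. Let $\Phi$ be the standard normal distribution function. **Theorem 3.1.** Suppose that either (I) $\tfrac12<a<1$, or (II) $a=\tfrac12$ and $L(t)/\sqrt{\log t}\to0$ as $t\to\infty$. Then, as $m\to\infty$, for every fixed $\eta\in(0,\tfrac12)$ and $\delta\in(0,1)$, $$mp\Big[2\Phi\big(\sqrt{2aC}\big)-1\Big](1+o(1))\;\le\;R_{OG}\;\le\; mp\Big[2\Phi\Big(\sqrt{\tfrac{2aC}{\eta(1-\delta)}}\Big)-1\Big](1+o(1)),$$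 where the two $o(1)$ terms need not be the same, that in the lower bound does not depend on $\eta,\delta$, and that in the upper bound may depend on $\eta,\delta$. Consequently, for every fixed $\eta\in(0,\tfrac12)$ and $\delta\in(0,1)$, $$\frac{2\Phi(\sqrt{2aC})-1}{2\Phi(\sqrt C)-1}(1+o(1))\;\le\;\frac{R_{OG}}{R^{BO}_{Opt}}\;\le\;\frac{2\Phi\big(\sqrt{2aC/(\eta(1-\delta))}\big)-1}{2\Phi(\sqrt C)-1}(1+o(1)),$$ with the same dependence of the $o(1)$ terms on $\eta,\delta$. In particular $R_{OG}=O(R^{BO}_{Opt})$: the rule is within a constant factor of the Bayes Oracle risk. -/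

import Mathlib

open MeasureTheory ProbabilityTheory Filter Topology

noncomputable section

/-! ### The two-groups model and the Bayes risk -/

/-- Joint law of one pair `(ν, X)` in the two-groups model with unit noise variance:
`ν ~ Bernoulli(p)` (`true` encodes `ν = 1`), `X ∣ ν = 0 ~ N(0, 1)` and
`X ∣ ν = 1 ~ N(0, 1 + ψ²)`. The marginal law of `X` is `(1 - p) N(0, 1) + p N(0, 1 + ψ²)`. -/
def twoGroupsLaw (p ψ : ℝ) : Measure (Bool × ℝ) :=
  ENNReal.ofReal (1 - p) • (Measure.dirac false).prod (gaussianReal 0 1) +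
    ENNReal.ofReal p • (Measure.dirac true).prod (gaussianReal 0 (1 + ψ ^ 2).toNNReal)

/-- A multiple testing rule for `m` hypotheses: `d x i` means that `H₀ᵢ` is rejected when the data
are `x`. -/
abbrev TestingRule (m : ℕ) : Type := (Fin m → ℝ) → Fin m → Prop

open Classical in
/-- The additive 0-1 loss: the number of misclassified hypotheses, i.e. of the indices `i` at which
"`H₀ᵢ` is rejected" and "`νᵢ = 1`" do not agree. -/
def misclassified {m : ℕ} (d : TestingRule m) (ω : Fin m → Bool × ℝ) : ℝ :=
  ∑ i, if d (fun j => (ω j).2) i ↔ (ω i).1 = true then 0 else 1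

/-- The Bayes risk of a multiple testing rule: its expected loss when the pairs
`(νᵢ, Xᵢ)`, `i = 1, …, m`, are i.i.d. from the two-groups model. -/
def testingRisk {m : ℕ} (p ψ : ℝ) (d : TestingRule m) : ℝ :=
  ∫ ω, misclassified d ω ∂(Measure.pi fun _ : Fin m => twoGroupsLaw p ψ)

/-- The Bayes Oracle: reject `H₀ᵢ` iff `f(xᵢ ∣ νᵢ = 1) / f(xᵢ ∣ νᵢ = 0) > (1 - p) / p`. -/
def bayesOracle (m : ℕ) (p ψ : ℝ) : TestingRule m := fun x i =>
  gaussianPDFReal 0 (1 + ψ ^ 2).toNNReal (x i) / gaussianPDFReal 0 1 (x i) > (1 - p) / p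

/-- The asymptotic scheme, with `u = ψ²` and `v = u ((1 - p) / p)²`. -/
structure AsymptoticScheme (p ψ : ℕ → ℝ) (C : ℝ) : Prop where
  C_pos : 0 < C
  p_tendsto : Tendsto p atTop (𝓝 0)
  u_tendsto : Tendsto (fun m => ψ m ^ 2) atTop atTop
  v_tendsto : Tendsto (fun m => ψ m ^ 2 * ((1 - p m) / p m) ^ 2) atTop atTop
  log_v_div_u_tendsto :
    Tendsto (fun m => Real.log (ψ m ^ 2 * ((1 - p m) / p m) ^ 2) / ψ m ^ 2) atTop (𝓝 C)

/-! ### The one-group prior and the induced rule -/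

/-- A positive measurable function on `(0, ∞)` that is slowly varying at infinity in Karamata's
sense. The values of `L` outside `(0, ∞)` play no role. -/
structure IsSlowlyVarying (L : ℝ → ℝ) : Prop where
  pos : ∀ t, 0 < t → 0 < L t
  measurable : Measurable fun t : Set.Ioi (0 : ℝ) => L t
  ratio_tendsto : ∀ α : ℝ, 0 < α → Tendsto (fun x => L (α * x) / L x) atTop (𝓝 1)

/-- The prior law of a squared local shrinkage parameter `t = λ²`: density `K t^(-a-1) L(t)` with
respect to Lebesgue measure on `(0, ∞)`. -/
def localPrior (K a : ℝ) (L : ℝ → ℝ) : Measure ℝ :=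
  (volume.restrict (Set.Ioi 0)).withDensity
    fun t => ENNReal.ofReal (K * t ^ (-a - 1) * L t)

/-- The density at `x` of `X` given `λ² = t` in the hierarchy `X ∣ μ ~ N(μ, 1)`,
`μ ∣ λ² ~ N(0, λ² τ²)`: the density of `N(μ, 1)` at `x`, averaged over `μ ~ N(0, t τ²)`. -/
def localLikelihood (τ t x : ℝ) : ℝ :=
  ∫ μ, gaussianPDFReal μ 1 x ∂(gaussianReal 0 (t * τ ^ 2).toNNReal)

/-- The posterior mean `E(κ ∣ X = x, τ)` of the shrinkage coefficient `κ = 1 / (1 + λ² τ²)`, by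
Bayes' formula. -/
def postMeanKappa (K a : ℝ) (L : ℝ → ℝ) (τ x : ℝ) : ℝ :=
  (∫ t, 1 / (1 + t * τ ^ 2) * localLikelihood τ t x ∂(localPrior K a L)) /
    ∫ t, localLikelihood τ t x ∂(localPrior K a L)

/-- The rule induced by the one-group prior: reject `H₀ᵢ` iff `1 - E(κᵢ ∣ Xᵢ, τ) > 1/2`. -/
def oneGroupRule (m : ℕ) (K a : ℝ) (L : ℝ → ℝ) (τ : ℝ) : TestingRule m := fun x i =>
  1 - postMeanKappa K a L τ (x i) > 1 / 2

/-- The standard normal distribution function `Φ`. -/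
def stdNormalCDF (x : ℝ) : ℝ := cdf (gaussianReal 0 1) x

end

/-!
The rule decides each hypothesis from its own observation, so its risk is `m p` times the risk per
signal `((1 - p) / p) t₁ + t₂`, where `t₁ = P(X ∈ D)` for `X ~ N(0, 1)` and `t₂ = P(X ∉ D)` for
`X ~ N(0, 1 + ψ²)`, with `D` the rejection region (`testingRisk_oneGroupRule`). Put
`ℓ = log (1 / τ²)`. Eventually `D` lies between two regions `{x² > B ℓ}`, and the scheme
gives `ℓ / (1 + ψ²) → C` (`tendsto_log_one_div_sq_div`), so that `P(X² ≤ B ℓ) → 2 Φ(√(B C)) - 1`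
under `N(0, 1 + ψ²)`.

Lower bound. With `κ = 1 / (1 + t τ²)`, the posterior mean of `1 - κ` is at most `exp (x² / 2)` times
a constant multiple of the prior signal mass `h(τ) = E[(1 - κ) √κ]`
(`one_sub_posteriorShrinkage_le`). Since `h(τ) = O(τ ^ (2 b))` for all `b < a`, observations with
`x² ≤ B ℓ`, `B < 2 a`, are not rejected (`eventually_subset_compl_rejectionRegion`), and the limit
inferior of `t₂` is at least `2 Φ(√(2 a C)) - 1`.

Upper bound. The same inequality with `h(τ) = o(τ √ℓ)` (`eventually_signalMass_le`) and Mills' bound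
show `t₁ = o(τ) = o(p)` (`tendsto_gaussianReal_rejectionRegion_div`). This is where `a ≥ 1/2` and,
for `a = 1/2`, the growth condition on `L` are needed. For `t₂`, the posterior mean of `κ` is at most
`q` plus a ratio that compares `κ > q` with `κ ≤ q'` (`posteriorShrinkage_le`), and the prior mass of
`{κ ≤ q'}` is at least `τ ^ (2 b)` up to a constant, for every `b > a`. Hence observations with
`x² > B ℓ` are rejected as soon as `B > 2 a / ρ` with `ρ = q - q' < 1/2`
(`eventually_subset_rejectionRegion`). As `η (1 - δ) < 1/2` strictly, `ρ` and `B` can be chosen with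
`B < 2 a / (η (1 - δ))`, so the upper bound even holds with error term `0`.

The estimates on the prior need neither Karamata's uniform convergence theorem nor Potter's bounds:
the single limit `L (2 t) / L t → 1` compares integrals over `(X, ∞)` and `(2 X, ∞)`, and iterating
this gives the moments of order `b < a` (`integrable_rpow_localPrior`) and the lower bound on dyadic
blocks (`exists_le_localPrior_Ioc`).

The Bayes Oracle rejects iff `x²` exceeds a threshold `s` with `s / (1 + ψ²) → C` whose type I error
is negligible, so its risk per signal tends to `2 Φ(√C) - 1` (`tendsto_riskPerSignal_oracle`).
-/

noncomputable section

/-! ### Gaussian probabilities -/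

/-- The distribution function of `Z²` for a standard normal `Z`, i.e. `P(Z² ≤ y) = 2 Φ(√y) - 1`. -/
def chiSqCDF (y : ℝ) : ℝ := 2 * stdNormalCDF (√y) - 1

lemma gaussianPDFReal_zero_one_le (x : ℝ) : gaussianPDFReal 0 1 x ≤ Real.exp (-x ^ 2 / 2) := by
  rw [gaussianPDFReal]
  have h1 : (√(2 * Real.pi * (1 : NNReal)))⁻¹ ≤ 1 := by
    apply inv_le_one_of_one_le₀
    rw [Real.one_le_sqrt]
    push_cast
    nlinarith [Real.pi_gt_three]
  calc _ ≤ 1 * Real.exp (-(x - 0) ^ 2 / (2 * (1 : NNReal))) := by gcongr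
    _ = _ := by simp

lemma stdNormalCDF_sub {x y : ℝ} (hxy : x ≤ y) :
    stdNormalCDF y - stdNormalCDF x = (gaussianReal 0 1).real (Set.Ioc x y) := by
  rw [stdNormalCDF, stdNormalCDF, cdf_eq_real, cdf_eq_real, ← Set.Iic_sdiff_Iic,
    measureReal_sdiff (Set.Iic_subset_Iic.2 hxy) measurableSet_Iic]

lemma strictMono_stdNormalCDF : StrictMono stdNormalCDF := by
  intro x y hxy
  rw [← sub_pos, stdNormalCDF_sub hxy.le, measureReal_def, ENNReal.toReal_pos_iff]
  refine ⟨pos_iff_ne_zero.2 fun h => ?_, measure_lt_top _ _⟩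
  have := gaussianReal_absolutelyContinuous' 0 one_ne_zero h
  simp [hxy.not_ge] at this

lemma continuous_stdNormalCDF : Continuous stdNormalCDF := by
  have key : ∀ x y, x ≤ y → stdNormalCDF y - stdNormalCDF x ≤ y - x := by
    intro x y hxy
    rw [stdNormalCDF_sub hxy, measureReal_def]
    refine ENNReal.toReal_le_of_le_ofReal (by linarith) ?_
    rw [gaussianReal_apply 0 one_ne_zero]
    calc _ ≤ ∫⁻ _ in Set.Ioc x y, 1 := by
          refine lintegral_mono fun t => ?_
          rw [gaussianPDF]
          refine ENNReal.ofReal_le_one.2 ((gaussianPDFReal_zero_one_le t).trans ?_)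
          rw [Real.exp_le_one_iff]
          nlinarith [sq_nonneg t]
      _ = _ := by simp
  refine (LipschitzWith.of_le_add fun x y => ?_ : LipschitzWith 1 stdNormalCDF).continuous
  rw [Real.dist_eq]
  rcases le_total x y with h | h
  · have := strictMono_stdNormalCDF.monotone h
    linarith [abs_nonneg (x - y)]
  · have := key y x h
    linarith [le_abs_self (x - y)]

lemma continuous_chiSqCDF : Continuous chiSqCDF := by
  unfold chiSqCDF
  have := continuous_stdNormalCDF
  fun_prop

lemma chiSqCDF_lt_chiSqCDF {x y : ℝ} (hx : 0 ≤ x) (hxy : x < y) : chiSqCDF x < chiSqCDF y := by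
  have := strictMono_stdNormalCDF (Real.sqrt_lt_sqrt hx hxy)
  unfold chiSqCDF
  linarith

lemma gaussianReal_Iio_neg (r : ℝ) :
    (gaussianReal 0 1).real (Set.Iio (-r)) = (gaussianReal 0 1).real (Set.Ioi r) := by
  have h : (gaussianReal 0 1).map (fun x => -x) = gaussianReal 0 1 := by
    rw [gaussianReal_map_neg, neg_zero]
  conv_rhs => rw [← h]
  rw [map_measureReal_apply measurable_neg measurableSet_Ioi]
  congr 1
  ext x
  simp only [Set.mem_Iio, Set.mem_preimage, Set.mem_Ioi]
  constructor <;> intro h <;> linarith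

lemma gaussianReal_sq_le_eq_chiSqCDF {s : ℝ} (hs : 0 ≤ s) :
    (gaussianReal 0 1).real {x | x ^ 2 ≤ s} = chiSqCDF s := by
  have h1 : {x : ℝ | x ^ 2 ≤ s} = Set.Iic √s \ Set.Iio (-√s) := by
    ext x
    simp only [Set.mem_ofPred_eq, Set.mem_sdiff, Set.mem_Iic, Set.mem_Iio, not_lt]
    rw [Real.sq_le hs, and_comm]
  have h2 : (gaussianReal 0 1).real (Set.Ioi √s) = 1 - stdNormalCDF √s := by
    rw [stdNormalCDF, cdf_eq_real, ← Set.compl_Iic, probReal_compl_eq_one_sub measurableSet_Iic]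
  rw [h1, measureReal_sdiff _ measurableSet_Iio, gaussianReal_Iio_neg, h2, ← cdf_eq_real, chiSqCDF,
    ← stdNormalCDF]
  · ring
  · intro x hx
    simp only [Set.mem_Iio, Set.mem_Iic] at *
    linarith [Real.sqrt_nonneg s]

lemma chiSqCDF_zero : chiSqCDF 0 = 0 := by
  have := nullSingletonClass_gaussianReal (μ := 0) (one_ne_zero : (1 : NNReal) ≠ 0)
  rw [← gaussianReal_sq_le_eq_chiSqCDF le_rfl]
  have h : {x : ℝ | x ^ 2 ≤ 0} = {0} := by
    ext x
    simp [sq_nonpos_iff]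
  rw [h, measureReal_def, measure_singleton, ENNReal.toReal_zero]

lemma chiSqCDF_pos {y : ℝ} (hy : 0 < y) : 0 < chiSqCDF y :=
  chiSqCDF_zero ▸ chiSqCDF_lt_chiSqCDF le_rfl hy

lemma gaussianReal_toNNReal_sq_le {w s : ℝ} (hw : 0 < w) (hs : 0 ≤ s) :
    (gaussianReal 0 w.toNNReal).real {x | x ^ 2 ≤ s} = chiSqCDF (s / w) := by
  have h : gaussianReal 0 w.toNNReal = (gaussianReal 0 1).map (√w * ·) := by
    rw [gaussianReal_map_const_mul, mul_zero, mul_one]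
    congr 1
    ext
    simp [Real.sq_sqrt hw.le, hw.le]
  rw [← gaussianReal_sq_le_eq_chiSqCDF (by positivity), h,
    map_measureReal_apply (by fun_prop) (measurableSet_le (by fun_prop) (by fun_prop))]
  congr 1
  ext x
  simp only [Set.preimage_ofPred_eq, Set.mem_ofPred_eq, mul_pow, Real.sq_sqrt hw.le]
  rw [le_div_iff₀ hw, mul_comm]

lemma gaussianReal_Ioi_le {r : ℝ} (hr : 0 < r) :
    (gaussianReal 0 1).real (Set.Ioi r) ≤ Real.exp (-r ^ 2 / 2) / r := by
  have hderiv : ∀ x ∈ Set.Ici r,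
      HasDerivAt (fun x => -(Real.exp (-x ^ 2 / 2) / r)) (x / r * Real.exp (-x ^ 2 / 2)) x := by
    intro x _
    have h := (((((hasDerivAt_id x).pow 2).neg).div_const 2).exp.div_const r).neg
    refine h.congr_deriv ?_
    simp
    field_simp
  have hlim : Tendsto (fun x : ℝ => -(Real.exp (-x ^ 2 / 2) / r)) atTop (𝓝 0) := by
    have h1 : Tendsto (fun x : ℝ => -x ^ 2 / 2) atTop atBot := by
      have := ((tendsto_pow_atTop (α := ℝ) two_ne_zero).atTop_div_const
        (zero_lt_two : (0 : ℝ) < 2))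
      refine (tendsto_neg_atTop_atBot.comp this).congr fun x => ?_
      simp [neg_div]
    simpa using ((Real.tendsto_exp_atBot.comp h1).div_const r).neg
  have hnn : ∀ x ∈ Set.Ioi r, 0 ≤ x / r * Real.exp (-x ^ 2 / 2) := fun x hx => by
    have : 0 < x := hr.trans hx
    positivity
  have hint := integral_Ioi_of_hasDerivAt_of_nonneg' hderiv hnn hlim
  have hi := integrableOn_Ioi_deriv_of_nonneg' hderiv hnn hlim
  have h := gaussianReal_apply_eq_integral 0 one_ne_zero (Set.Ioi r)
  rw [measureReal_def, h, ENNReal.toReal_ofReal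
    (integral_nonneg fun x => gaussianPDFReal_nonneg _ _ _)]
  calc _ ≤ ∫ x in Set.Ioi r, x / r * Real.exp (-x ^ 2 / 2) := by
        refine setIntegral_mono_on (integrable_gaussianPDFReal 0 1).integrableOn hi
          measurableSet_Ioi fun x hx => (gaussianPDFReal_zero_one_le x).trans ?_
        exact le_mul_of_one_le_left (Real.exp_nonneg _) ((one_le_div hr).2 (le_of_lt hx))
    _ = _ := by rw [hint]; ring

/-- Mills' bound for the tail of the square of a standard normal variable. -/
lemma gaussianReal_lt_sq_le {s : ℝ} (hs : 0 < s) :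
    (gaussianReal 0 1).real {x | s < x ^ 2} ≤ 2 * (Real.exp (-s / 2) / √s) := by
  have h1 : {x : ℝ | s < x ^ 2} ⊆ Set.Iio (-√s) ∪ Set.Ioi √s := by
    intro x hx
    simp only [Set.mem_ofPred_eq, Set.mem_union, Set.mem_Iio, Set.mem_Ioi] at *
    have habs : √s < |x| := by
      rw [← Real.sqrt_sq_eq_abs]
      exact Real.sqrt_lt_sqrt hs.le hx
    rcases lt_abs.1 habs with h | h
    · exact Or.inr h
    · left; linarith
  have h2 := gaussianReal_Ioi_le (Real.sqrt_pos.2 hs)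
  rw [Real.sq_sqrt hs.le] at h2
  calc _ ≤ _ := measureReal_mono h1
    _ ≤ _ := measureReal_union_le _ _
    _ ≤ _ := by rw [gaussianReal_Iio_neg]; linarith

/-! ### The Bayes risk of a coordinatewise rule -/

lemma isProbabilityMeasure_twoGroupsLaw {p : ℝ} (hp0 : 0 < p) (hp1 : p < 1) (ψ : ℝ) :
    IsProbabilityMeasure (twoGroupsLaw p ψ) := by
  constructor
  simp only [twoGroupsLaw, Measure.coe_add, Measure.coe_smul, Pi.add_apply, Pi.smul_apply,
    measure_univ, smul_eq_mul, mul_one]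
  rw [← ENNReal.ofReal_add (by linarith) hp0.le]
  simp

lemma measureReal_dirac_prod (b : Bool) (γ : Measure ℝ) [SFinite γ] {A : Set (Bool × ℝ)}
    (hA : MeasurableSet A) : ((Measure.dirac b).prod γ).real A = γ.real {x | (b, x) ∈ A} := by
  rw [Measure.dirac_prod, map_measureReal_apply measurable_prodMk_left hA]
  rfl

/-- A rule that rejects `H₀ᵢ` iff `xᵢ` lies in a fixed region `D` has risk `m` times the weighted
sum of its two error probabilities. -/
lemma testingRisk_eq_of_region {m : ℕ} {p : ℝ} (hp0 : 0 < p) (hp1 : p < 1) (ψ : ℝ)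
    {d : TestingRule m} {D : Set ℝ} (hD : MeasurableSet D) (hd : ∀ x i, d x i ↔ x i ∈ D) :
    testingRisk p ψ d = m * ((1 - p) * (gaussianReal 0 1).real D +
      p * (gaussianReal 0 (1 + ψ ^ 2).toNNReal).real Dᶜ) := by
  have := isProbabilityMeasure_twoGroupsLaw hp0 hp1 ψ
  set A : Set (Bool × ℝ) := {z | ¬ (z.2 ∈ D ↔ z.1 = true)} with hAdef
  have hA : MeasurableSet A := by
    have h1 : MeasurableSet {z : Bool × ℝ | z.2 ∈ D} := measurable_snd hD
    have h2 : MeasurableSet {z : Bool × ℝ | z.1 = true} :=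
      measurable_fst (measurableSet_singleton true)
    exact (h1.iff h2).compl
  have hlaw : (twoGroupsLaw p ψ).real A = (1 - p) * (gaussianReal 0 1).real D +
      p * (gaussianReal 0 (1 + ψ ^ 2).toNNReal).real Dᶜ := by
    rw [twoGroupsLaw, measureReal_add_apply
      (ENNReal.mul_ne_top ENNReal.ofReal_ne_top (measure_ne_top _ _))
      (ENNReal.mul_ne_top ENNReal.ofReal_ne_top (measure_ne_top _ _)),
      measureReal_ennreal_smul_apply, measureReal_ennreal_smul_apply,
      ENNReal.toReal_ofReal (by linarith), ENNReal.toReal_ofReal hp0.le,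
      measureReal_dirac_prod _ _ hA, measureReal_dirac_prod _ _ hA]
    have h1 : {x | (false, x) ∈ A} = D := by
      ext x
      change ¬ (x ∈ D ↔ false = true) ↔ x ∈ D
      simp
    have h2 : {x | (true, x) ∈ A} = Dᶜ := by
      ext x
      change ¬ (x ∈ D ↔ true = true) ↔ x ∉ D
      simp
    rw [h1, h2]
  have hloss : ∀ ω : Fin m → Bool × ℝ,
      misclassified d ω = ∑ i, A.indicator (fun _ => (1 : ℝ)) (ω i) := by
    intro ω
    rw [misclassified]
    refine Finset.sum_congr rfl fun i _ => ?_
    have hi : ω i ∈ A ↔ ¬ (d (fun j => (ω j).2) i ↔ (ω i).1 = true) := by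
      rw [hd]
      rfl
    by_cases h : ω i ∈ A
    · rw [Set.indicator_of_mem h, if_neg (hi.1 h)]
    · rw [Set.indicator_of_notMem h, if_pos (not_not.1 (mt hi.2 h))]
  have hmp : ∀ i : Fin m, MeasurePreserving (Function.eval i)
      (Measure.pi fun _ : Fin m => twoGroupsLaw p ψ) (twoGroupsLaw p ψ) :=
    fun i => measurePreserving_eval (fun _ : Fin m => twoGroupsLaw p ψ) i
  have hind : Integrable (A.indicator fun _ => (1 : ℝ)) (twoGroupsLaw p ψ) :=
    (integrable_const 1).indicator hA
  have hcoord : ∀ i : Fin m, ∫ ω, A.indicator (fun _ => (1 : ℝ)) (ω i)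
      ∂(Measure.pi fun _ : Fin m => twoGroupsLaw p ψ) = (twoGroupsLaw p ψ).real A := by
    intro i
    rw [← integral_indicator_one hA]
    conv_rhs => rw [← (hmp i).map_eq]
    rw [integral_map (hmp i).aemeasurable]
    · rfl
    · rw [(hmp i).map_eq]
      exact hind.aestronglyMeasurable
  rw [testingRisk]
  simp only [hloss]
  have hint : ∀ i ∈ Finset.univ, Integrable
      (fun ω : Fin m → Bool × ℝ => A.indicator (fun _ => (1 : ℝ)) (ω i))
      (Measure.pi fun _ : Fin m => twoGroupsLaw p ψ) :=
    fun i _ => (hmp i).integrable_comp_of_integrable hind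
  rw [integral_finsetSum _ hint]
  simp only [hcoord, hlaw, Finset.sum_const, Finset.card_univ, Fintype.card_fin, nsmul_eq_mul]

/-! ### The posterior mean of the shrinkage coefficient -/

/-- The shrinkage coefficient `κ = 1 / (1 + t τ²)` as a function of `t = λ²`. -/
def shrinkage (τ t : ℝ) : ℝ := 1 / (1 + t * τ ^ 2)

/-- The density at `x` of `N(0, 1 / κ)` without its factor `1 / √(2π)`. -/
def shrinkageLikelihood (τ t x : ℝ) : ℝ :=
  √(shrinkage τ t) * Real.exp (-(shrinkage τ t * x ^ 2 / 2))

lemma shrinkage_pos {t : ℝ} (ht : 0 < t) (τ : ℝ) : 0 < shrinkage τ t := by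
  unfold shrinkage
  positivity

lemma shrinkage_le_one {t : ℝ} (ht : 0 < t) (τ : ℝ) : shrinkage τ t ≤ 1 := by
  unfold shrinkage
  rw [div_le_one (by positivity)]
  nlinarith [mul_nonneg ht.le (sq_nonneg τ)]

lemma measurable_shrinkage (τ : ℝ) : Measurable (shrinkage τ) := by
  unfold shrinkage
  fun_prop

lemma measurable_shrinkageLikelihood (τ : ℝ) :
    Measurable fun z : ℝ × ℝ => shrinkageLikelihood τ z.2 z.1 := by
  unfold shrinkageLikelihood
  have := measurable_shrinkage τ
  fun_prop

lemma shrinkageLikelihood_nonneg (τ t x : ℝ) : 0 ≤ shrinkageLikelihood τ t x := by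
  unfold shrinkageLikelihood
  positivity

lemma shrinkageLikelihood_le_one {t : ℝ} (ht : 0 < t) (τ x : ℝ) :
    shrinkageLikelihood τ t x ≤ 1 := by
  have h := shrinkage_pos ht τ
  refine mul_le_one₀ (Real.sqrt_le_one.2 (shrinkage_le_one ht τ)) (Real.exp_nonneg _) ?_
  rw [Real.exp_le_one_iff]
  have : 0 ≤ shrinkage τ t * x ^ 2 / 2 := by positivity
  linarith

/-- Completing the square: the convolution of `N(0, 1)` and `N(0, t τ²)` is `N(0, 1 + t τ²)`. -/
lemma localLikelihood_eq {τ t : ℝ} (hτ : 0 < τ) (ht : 0 < t) (x : ℝ) :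
    localLikelihood τ t x = (√(2 * Real.pi))⁻¹ * shrinkageLikelihood τ t x := by
  set v : ℝ := t * τ ^ 2 with hv
  have hv0 : 0 < v := by positivity
  have hvn : v.toNNReal ≠ 0 := by simpa using hv0
  set s : ℝ := v / (1 + v) with hs
  have hs0 : 0 < s := by positivity
  have hsn : s.toNNReal ≠ 0 := by simpa using hs0
  have hk : shrinkage τ t = 1 / (1 + v) := rfl
  have key : ∀ μ, gaussianPDFReal 0 v.toNNReal μ • gaussianPDFReal μ 1 x =
      (√(2 * Real.pi))⁻¹ * shrinkageLikelihood τ t x *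
        gaussianPDFReal (x * s) s.toNNReal μ := by
    intro μ
    simp only [gaussianPDFReal, smul_eq_mul, shrinkageLikelihood, hk, Real.coe_toNNReal _ hv0.le,
      Real.coe_toNNReal _ hs0.le, NNReal.coe_one, mul_one]
    have hexp : -(μ - 0) ^ 2 / (2 * v) + -(x - μ) ^ 2 / 2 =
        -(1 / (1 + v) * x ^ 2 / 2) + -(μ - x * s) ^ 2 / (2 * s) := by
      rw [hs]
      field_simp
      ring
    have hroot : (√(2 * Real.pi * v))⁻¹ = √(1 / (1 + v)) * (√(2 * Real.pi * s))⁻¹ := by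
      rw [← Real.sqrt_inv, ← Real.sqrt_inv, ← Real.sqrt_mul (by positivity)]
      congr 1
      rw [hs]
      field_simp
    calc _ = (√(2 * Real.pi * v))⁻¹ * (√(2 * Real.pi))⁻¹ *
          (Real.exp (-(μ - 0) ^ 2 / (2 * v)) * Real.exp (-(x - μ) ^ 2 / 2)) := by ring
      _ = _ := by
        rw [← Real.exp_add, hexp, Real.exp_add, hroot]
        ring
  rw [localLikelihood, integral_gaussianReal_eq_integral_smul hvn]
  simp only [key]
  rw [integral_const_mul, integral_gaussianPDFReal_eq_one _ hsn, mul_one]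

/-- The posterior mean of `κ` when `λ²` has prior law `π`. -/
def posteriorShrinkage (π : Measure ℝ) (τ x : ℝ) : ℝ :=
  (∫ t, shrinkage τ t * shrinkageLikelihood τ t x ∂π) / ∫ t, shrinkageLikelihood τ t x ∂π

lemma ae_pos_localPrior (K a : ℝ) (L : ℝ → ℝ) : ∀ᵐ t ∂(localPrior K a L), 0 < t :=
  (withDensity_absolutelyContinuous _ _).ae_le (ae_restrict_mem measurableSet_Ioi)

lemma postMeanKappa_eq_posteriorShrinkage {K a : ℝ} {L : ℝ → ℝ} {τ : ℝ} (hτ : 0 < τ) (x : ℝ) :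
    postMeanKappa K a L τ x = posteriorShrinkage (localPrior K a L) τ x := by
  have h1 : ∫ t, 1 / (1 + t * τ ^ 2) * localLikelihood τ t x ∂(localPrior K a L) =
      (√(2 * Real.pi))⁻¹ *
        ∫ t, shrinkage τ t * shrinkageLikelihood τ t x ∂(localPrior K a L) := by
    rw [← integral_const_mul]
    refine integral_congr_ae ?_
    filter_upwards [ae_pos_localPrior K a L] with t ht
    rw [localLikelihood_eq hτ ht, shrinkage]
    ring
  have h2 : ∫ t, localLikelihood τ t x ∂(localPrior K a L) =
      (√(2 * Real.pi))⁻¹ * ∫ t, shrinkageLikelihood τ t x ∂(localPrior K a L) := by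
    rw [← integral_const_mul]
    refine integral_congr_ae ?_
    filter_upwards [ae_pos_localPrior K a L] with t ht
    rw [localLikelihood_eq hτ ht]
  rw [postMeanKappa, h1, h2, posteriorShrinkage, mul_div_mul_left _ _ (by positivity)]

section Posterior

variable {π : Measure ℝ} [IsProbabilityMeasure π]

lemma measurable_posteriorShrinkage (τ : ℝ) : Measurable (posteriorShrinkage π τ) := by
  have h := measurable_shrinkageLikelihood τ
  have h' := measurable_shrinkage τ
  refine Measurable.div ?_ ?_
  · exact (Measurable.stronglyMeasurable (f := fun z : ℝ × ℝ =>
      shrinkage τ z.2 * shrinkageLikelihood τ z.2 z.1) (by fun_prop)).integral_prod_right'.measurable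
  · exact h.stronglyMeasurable.integral_prod_right'.measurable

lemma integrable_shrinkageLikelihood (hπ : ∀ᵐ t ∂π, 0 < t) (τ x : ℝ) :
    Integrable (fun t => shrinkageLikelihood τ t x) π := by
  refine Integrable.of_bound (C := 1) ?_ ?_
  · exact ((measurable_shrinkageLikelihood τ).comp
      measurable_prodMk_left).aestronglyMeasurable
  · filter_upwards [hπ] with t ht
    rw [Real.norm_of_nonneg (shrinkageLikelihood_nonneg _ _ _)]
    exact shrinkageLikelihood_le_one ht _ _

lemma integrable_shrinkage_mul (hπ : ∀ᵐ t ∂π, 0 < t) (τ x : ℝ) :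
    Integrable (fun t => shrinkage τ t * shrinkageLikelihood τ t x) π := by
  refine (integrable_shrinkageLikelihood hπ τ x).bdd_mul (c := 1)
    (measurable_shrinkage τ).aestronglyMeasurable ?_
  filter_upwards [hπ] with t ht
  rw [Real.norm_of_nonneg (shrinkage_pos ht _).le]
  exact shrinkage_le_one ht _

lemma integrable_sqrt_shrinkage (hπ : ∀ᵐ t ∂π, 0 < t) (τ : ℝ) :
    Integrable (fun t => √(shrinkage τ t)) π := by
  simpa [shrinkageLikelihood] using integrable_shrinkageLikelihood hπ τ 0

/-- The expectation of `(1 - κ) √κ` under the prior: the mass that the prior gives to signals. -/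
def signalMass (π : Measure ℝ) (τ : ℝ) : ℝ := ∫ t, (1 - shrinkage τ t) * √(shrinkage τ t) ∂π

lemma integrable_signalMass (hπ : ∀ᵐ t ∂π, 0 < t) (τ : ℝ) :
    Integrable (fun t => (1 - shrinkage τ t) * √(shrinkage τ t)) π := by
  refine (integrable_sqrt_shrinkage hπ τ).bdd_mul (c := 1)
    (measurable_const.sub (measurable_shrinkage τ)).aestronglyMeasurable ?_
  filter_upwards [hπ] with t ht
  have h1 := shrinkage_pos ht τ
  have h2 := shrinkage_le_one ht τ
  rw [Real.norm_of_nonneg (by linarith)]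
  linarith

lemma one_sub_shrinkage_mul_sqrt_nonneg {t : ℝ} (ht : 0 < t) (τ : ℝ) :
    0 ≤ (1 - shrinkage τ t) * √(shrinkage τ t) :=
  mul_nonneg (sub_nonneg.2 (shrinkage_le_one ht τ)) (Real.sqrt_nonneg _)

lemma signalMass_nonneg {π : Measure ℝ} (hπ : ∀ᵐ t ∂π, 0 < t) (τ : ℝ) : 0 ≤ signalMass π τ :=
  integral_nonneg_of_ae (hπ.mono fun _ ht => one_sub_shrinkage_mul_sqrt_nonneg ht τ)

lemma integral_sqrt_shrinkage_pos (hπ : ∀ᵐ t ∂π, 0 < t) (τ : ℝ) :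
    0 < ∫ t, √(shrinkage τ t) ∂π := by
  rw [integral_pos_iff_support_of_nonneg_ae (Eventually.of_forall fun t => Real.sqrt_nonneg _)
    (integrable_sqrt_shrinkage hπ τ)]
  have : (Function.support fun t => √(shrinkage τ t)) =ᵐ[π] Set.univ := by
    filter_upwards [hπ] with t ht
    exact propext ⟨fun _ => trivial, fun _ => (Real.sqrt_pos.2 (shrinkage_pos ht τ)).ne'⟩
  rw [measure_congr this]
  simp

lemma exp_mul_integral_sqrt_shrinkage_le (hπ : ∀ᵐ t ∂π, 0 < t) {τ : ℝ} (hτ0 : 0 < τ)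
    (hτ1 : τ ≤ 1) (x : ℝ) :
    Real.exp (-(x ^ 2 / 2)) * ∫ t, √(shrinkage 1 t) ∂π ≤ ∫ t, shrinkageLikelihood τ t x ∂π := by
  rw [← integral_const_mul]
  refine integral_mono_ae ((integrable_sqrt_shrinkage hπ 1).const_mul _)
    (integrable_shrinkageLikelihood hπ τ x) ?_
  filter_upwards [hπ] with t ht
  have h1 : shrinkage 1 t ≤ shrinkage τ t := by
    unfold shrinkage
    gcongr
  have h2 := shrinkage_le_one ht τ
  rw [shrinkageLikelihood, mul_comm]
  have h3 : shrinkage τ t * x ^ 2 / 2 ≤ x ^ 2 / 2 := by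
    nlinarith [sq_nonneg x]
  gcongr

/-- The posterior mean of `1 - κ` is at most the prior signal mass times `exp (x² / 2)`, up to a
constant that does not depend on `τ ≤ 1`: the factor `exp (-κ x² / 2)` lies between `exp (-x² / 2)`
and `1`. -/
lemma one_sub_posteriorShrinkage_le (hπ : ∀ᵐ t ∂π, 0 < t) {τ : ℝ} (hτ0 : 0 < τ) (hτ1 : τ ≤ 1)
    (x : ℝ) : 1 - posteriorShrinkage π τ x ≤
      Real.exp (x ^ 2 / 2) * signalMass π τ / ∫ t, √(shrinkage 1 t) ∂π := by
  have hg := integral_sqrt_shrinkage_pos hπ 1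
  have hden := exp_mul_integral_sqrt_shrinkage_le hπ hτ0 hτ1 x
  have hpos : 0 < ∫ t, shrinkageLikelihood τ t x ∂π := lt_of_lt_of_le (by positivity) hden
  have hnum : (∫ t, shrinkageLikelihood τ t x ∂π) -
      ∫ t, shrinkage τ t * shrinkageLikelihood τ t x ∂π ≤ signalMass π τ := by
    rw [← integral_sub (integrable_shrinkageLikelihood hπ τ x) (integrable_shrinkage_mul hπ τ x)]
    refine integral_mono_ae ((integrable_shrinkageLikelihood hπ τ x).sub
      (integrable_shrinkage_mul hπ τ x)) (integrable_signalMass hπ τ) ?_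
    filter_upwards [hπ] with t ht
    have h1 := shrinkage_pos ht τ
    have h2 := shrinkage_le_one ht τ
    have h3 : shrinkageLikelihood τ t x ≤ √(shrinkage τ t) := by
      refine mul_le_of_le_one_right (Real.sqrt_nonneg _) (Real.exp_le_one_iff.2 ?_)
      have : 0 ≤ shrinkage τ t * x ^ 2 / 2 := by positivity
      linarith
    have h4 := mul_le_mul_of_nonneg_left h3 (sub_nonneg.2 h2)
    linarith
  have hmass := signalMass_nonneg hπ τ
  rw [posteriorShrinkage, one_sub_div hpos.ne', div_le_div_iff₀ hpos hg]
  have hee : Real.exp (x ^ 2 / 2) * Real.exp (-(x ^ 2 / 2)) = 1 := by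
    rw [← Real.exp_add]
    simp
  calc _ ≤ signalMass π τ * ∫ t, √(shrinkage 1 t) ∂π := by gcongr
    _ = Real.exp (x ^ 2 / 2) * signalMass π τ *
        (Real.exp (-(x ^ 2 / 2)) * ∫ t, √(shrinkage 1 t) ∂π) := by
      linear_combination (-(signalMass π τ * ∫ t, √(shrinkage 1 t) ∂π)) * hee
    _ ≤ _ := by gcongr

/-- The posterior mean of `κ` is at most `q` up to a term that compares the weight of `κ > q` with
that of `κ ≤ q'`. -/
lemma posteriorShrinkage_le (hπ : ∀ᵐ t ∂π, 0 < t) {τ q q' c : ℝ} (hq : 0 ≤ q) (hc : 0 < c)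
    (hmass : c ≤ ∫ t in {t | shrinkage τ t ≤ q'}, √(shrinkage τ t) ∂π) (x : ℝ) :
    posteriorShrinkage π τ x ≤ q + Real.exp (-((q - q') * x ^ 2 / 2)) / c := by
  have hden : Real.exp (-(q' * x ^ 2 / 2)) * c ≤ ∫ t, shrinkageLikelihood τ t x ∂π := by
    calc _ ≤ Real.exp (-(q' * x ^ 2 / 2)) *
          ∫ t in {t | shrinkage τ t ≤ q'}, √(shrinkage τ t) ∂π := by gcongr
      _ = ∫ t in {t | shrinkage τ t ≤ q'}, Real.exp (-(q' * x ^ 2 / 2)) * √(shrinkage τ t) ∂π :=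
          (integral_const_mul _ _).symm
      _ ≤ ∫ t in {t | shrinkage τ t ≤ q'}, shrinkageLikelihood τ t x ∂π := by
          refine setIntegral_mono_on ((integrable_sqrt_shrinkage hπ τ).const_mul _).integrableOn
            (integrable_shrinkageLikelihood hπ τ x).integrableOn
            (measurableSet_le (measurable_shrinkage τ) measurable_const) fun t ht => ?_
          rw [shrinkageLikelihood, mul_comm]
          have : shrinkage τ t ≤ q' := ht
          gcongr
      _ ≤ _ := setIntegral_le_integral (integrable_shrinkageLikelihood hπ τ x)
          (Eventually.of_forall fun t => shrinkageLikelihood_nonneg τ t x)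
  have hpos : 0 < ∫ t, shrinkageLikelihood τ t x ∂π := lt_of_lt_of_le (by positivity) hden
  have hnum : ∫ t, shrinkage τ t * shrinkageLikelihood τ t x ∂π ≤
      q * (∫ t, shrinkageLikelihood τ t x ∂π) + Real.exp (-(q * x ^ 2 / 2)) := by
    have hconst : ∫ _, Real.exp (-(q * x ^ 2 / 2)) ∂π = Real.exp (-(q * x ^ 2 / 2)) := by simp
    rw [← integral_const_mul, ← hconst,
      ← integral_add ((integrable_shrinkageLikelihood hπ τ x).const_mul q) (integrable_const _)]
    refine integral_mono_ae (integrable_shrinkage_mul hπ τ x)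
      (((integrable_shrinkageLikelihood hπ τ x).const_mul q).add (integrable_const _)) ?_
    filter_upwards [hπ] with t ht
    have h0 := shrinkage_pos ht τ
    have h1 := shrinkage_le_one ht τ
    have h2 := shrinkageLikelihood_nonneg τ t x
    rcases le_or_gt (shrinkage τ t) q with h | h
    · have := mul_le_mul_of_nonneg_right h h2
      linarith [Real.exp_pos (-(q * x ^ 2 / 2))]
    · have h3 : (shrinkage τ t - q) * shrinkageLikelihood τ t x ≤
          Real.exp (-(q * x ^ 2 / 2)) := by
        calc _ ≤ 1 * (1 * Real.exp (-(q * x ^ 2 / 2))) := by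
              unfold shrinkageLikelihood
              gcongr
              · linarith
              · exact Real.sqrt_le_one.2 h1
          _ = _ := by ring
      linarith
  rw [posteriorShrinkage, div_le_iff₀ hpos, add_mul]
  refine hnum.trans (add_le_add le_rfl ?_)
  rw [div_mul_eq_mul_div, le_div_iff₀ hc]
  calc _ = Real.exp (-((q - q') * x ^ 2 / 2)) * (Real.exp (-(q' * x ^ 2 / 2)) * c) := by
        rw [← mul_assoc, ← Real.exp_add]
        ring_nf
    _ ≤ _ := by gcongr

end Posterior

/-! ### Tails and moments of a slowly varying prior -/

section Prior

variable {K a : ℝ} {L : ℝ → ℝ}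

lemma aemeasurable_localPrior_density (hL : IsSlowlyVarying L) :
    AEMeasurable (fun t => ENNReal.ofReal (K * t ^ (-a - 1) * L t))
      (volume.restrict (Set.Ioi 0)) := by
  have h : AEMeasurable L (volume.restrict (Set.Ioi 0)) :=
    aemeasurable_restrict_of_measurable_subtype measurableSet_Ioi hL.measurable
  fun_prop

lemma setLIntegral_localPrior (hL : IsSlowlyVarying L) {g : ℝ → ENNReal} (hg : Measurable g)
    {X : ℝ} (hX : 0 ≤ X) : ∫⁻ t in Set.Ioi X, g t ∂(localPrior K a L) =
      ∫⁻ t in Set.Ioi X, ENNReal.ofReal (K * t ^ (-a - 1) * L t) * g t := by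
  have hsub : volume.restrict (Set.Ioi X) ≤ (volume : Measure ℝ).restrict (Set.Ioi 0) :=
    Measure.restrict_mono (Set.Ioi_subset_Ioi hX) le_rfl
  rw [localPrior, restrict_withDensity measurableSet_Ioi,
    Measure.restrict_restrict measurableSet_Ioi, Set.inter_eq_self_of_subset_left
    (Set.Ioi_subset_Ioi hX), lintegral_withDensity_eq_lintegral_mul₀
    ((aemeasurable_localPrior_density hL).mono_measure hsub) hg.aemeasurable]
  rfl

lemma setLIntegral_Ioi_two_mul (F : ℝ → ENNReal) (X : ℝ) :
    ∫⁻ t in Set.Ioi (2 * X), F t = 2 * ∫⁻ t in Set.Ioi X, F (2 * t) := by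
  have h : (volume : Measure ℝ) = (2 : ENNReal) • Measure.map (2 * ·) volume := by
    have := Real.smul_map_volume_mul_left (two_ne_zero (α := ℝ))
    rwa [abs_two, ENNReal.ofReal_ofNat, eq_comm] at this
  have he : MeasurableEmbedding (fun x : ℝ => 2 * x) :=
    (Homeomorph.mulLeft₀ (2 : ℝ) two_ne_zero).measurableEmbedding
  conv_lhs => rw [h]
  rw [Measure.restrict_smul, lintegral_smul_measure, he.restrict_map, he.lintegral_map, smul_eq_mul]
  congr 3
  ext x
  simp

lemma setLIntegral_localPrior_Ioi_two_mul (hL : IsSlowlyVarying L) {g : ℝ → ENNReal}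
    (hg : Measurable g) {X : ℝ} (hX : 0 ≤ X) :
    ∫⁻ t in Set.Ioi (2 * X), g t ∂(localPrior K a L) =
      ∫⁻ t in Set.Ioi X, ENNReal.ofReal (2 ^ (-a) * (K * t ^ (-a - 1) * L (2 * t))) * g (2 * t) := by
  rw [setLIntegral_localPrior hL hg (by positivity), setLIntegral_Ioi_two_mul,
    ← lintegral_const_mul' _ _ (by simp)]
  refine setLIntegral_congr_fun measurableSet_Ioi fun t ht => ?_
  have ht0 : 0 < t := hX.trans_lt ht
  have h : (2 : ℝ) ^ (-a) = 2 * 2 ^ (-a - 1) := by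
    rw [Real.rpow_sub_one two_ne_zero]
    ring
  rw [← mul_assoc, ← ENNReal.ofReal_ofNat 2, ← ENNReal.ofReal_mul zero_le_two,
    Real.mul_rpow zero_le_two ht0.le, h]
  congr 2
  ring

/-- Doubling the argument multiplies the prior density by about `2 ^ (-a - 1)` far out, because
`L (2 t) / L t → 1`. -/
lemma exists_setLIntegral_localPrior_two_mul_le (hK : 0 < K) (hL : IsSlowlyVarying L) {r : ℝ}
    (hr : 1 < r) : ∃ X₀ : ℝ, 1 ≤ X₀ ∧ ∀ g : ℝ → ENNReal, Measurable g →
      ∫⁻ t in Set.Ioi (2 * X₀), g t ∂(localPrior K a L) ≤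
        ENNReal.ofReal (r * 2 ^ (-a)) * ∫⁻ t in Set.Ioi X₀, g (2 * t) ∂(localPrior K a L) := by
  obtain ⟨X₁, h1⟩ := eventually_atTop.1
    ((hL.ratio_tendsto 2 two_pos).eventually (gt_mem_nhds hr))
  refine ⟨max X₁ 1, le_max_right _ _, fun g hg => ?_⟩
  have hX : (0 : ℝ) ≤ max X₁ 1 := zero_le_one.trans (le_max_right _ _)
  rw [setLIntegral_localPrior_Ioi_two_mul hL hg hX, setLIntegral_localPrior hL (by fun_prop) hX,
    ← lintegral_const_mul' _ _ ENNReal.ofReal_ne_top]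
  refine setLIntegral_mono' measurableSet_Ioi fun t ht => ?_
  have ht0 : 0 < t := hX.trans_lt ht
  have h2 := h1 t ((le_max_left _ _).trans (le_of_lt ht))
  rw [div_lt_iff₀ (hL.pos t ht0)] at h2
  rw [← mul_assoc (ENNReal.ofReal _), ← ENNReal.ofReal_mul (by positivity)]
  refine mul_le_mul' (ENNReal.ofReal_le_ofReal ?_) le_rfl
  calc 2 ^ (-a) * (K * t ^ (-a - 1) * L (2 * t))
      ≤ 2 ^ (-a) * (K * t ^ (-a - 1) * (r * L t)) := by gcongr
    _ = _ := by ring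

lemma exists_le_setLIntegral_localPrior_two_mul (hK : 0 < K) (hL : IsSlowlyVarying L) {r : ℝ}
    (hr0 : 0 < r) (hr : r < 1) : ∃ X₀ : ℝ, 1 ≤ X₀ ∧ ∀ g : ℝ → ENNReal, Measurable g →
      ENNReal.ofReal (r * 2 ^ (-a)) * ∫⁻ t in Set.Ioi X₀, g (2 * t) ∂(localPrior K a L) ≤
        ∫⁻ t in Set.Ioi (2 * X₀), g t ∂(localPrior K a L) := by
  obtain ⟨X₁, h1⟩ := eventually_atTop.1
    ((hL.ratio_tendsto 2 two_pos).eventually (lt_mem_nhds hr))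
  refine ⟨max X₁ 1, le_max_right _ _, fun g hg => ?_⟩
  have hX : (0 : ℝ) ≤ max X₁ 1 := zero_le_one.trans (le_max_right _ _)
  rw [setLIntegral_localPrior_Ioi_two_mul hL hg hX, setLIntegral_localPrior hL (by fun_prop) hX,
    ← lintegral_const_mul' _ _ ENNReal.ofReal_ne_top]
  refine setLIntegral_mono' measurableSet_Ioi fun t ht => ?_
  have ht0 : 0 < t := hX.trans_lt ht
  have h2 := h1 t ((le_max_left _ _).trans (le_of_lt ht))
  rw [lt_div_iff₀ (hL.pos t ht0)] at h2
  rw [← mul_assoc (ENNReal.ofReal _), ← ENNReal.ofReal_mul (by positivity)]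
  refine mul_le_mul' (ENNReal.ofReal_le_ofReal ?_) le_rfl
  calc r * 2 ^ (-a) * (K * t ^ (-a - 1) * L t)
      = 2 ^ (-a) * (K * t ^ (-a - 1) * (r * L t)) := by ring
    _ ≤ 2 ^ (-a) * (K * t ^ (-a - 1) * L (2 * t)) := by gcongr

/-- The moments of order `b < a` are finite. The truncated tail moment `I` satisfies
`I ≤ θ (A + I)` with a fixed `θ < 1`, by doubling the argument, so it is bounded. -/
lemma integrable_rpow_localPrior (hK : 0 < K) (hL : IsSlowlyVarying L)
    [IsProbabilityMeasure (localPrior K a L)] {b : ℝ} (hb0 : 0 < b) (hba : b < a) :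
    Integrable (fun t => t ^ b) (localPrior K a L) := by
  set π := localPrior K a L with hπdef
  obtain ⟨X₀, hX1, hX⟩ := exists_setLIntegral_localPrior_two_mul_le (a := a) hK hL
    (Real.one_lt_rpow one_lt_two (by linarith : 0 < (a - b) / 2))
  set θ : ℝ := 2 ^ (-((a - b) / 2)) with hθdef
  have hθ0 : 0 < θ := by positivity
  have hθ1 : θ < 1 := Real.rpow_lt_one_of_one_lt_of_neg one_lt_two (by linarith)
  have hθ : (2 : ℝ) ^ ((a - b) / 2) * 2 ^ (-a) * 2 ^ b = θ := by
    rw [← Real.rpow_add two_pos, ← Real.rpow_add two_pos]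
    congr 1
    ring
  set A : ℝ := (2 * X₀) ^ b with hA
  have hA0 : 0 ≤ A := by positivity
  -- a moment truncated at `Y` is at most `Y ^ b`
  have hmom : ∀ Y : ℝ, 0 ≤ Y → ∫⁻ t in Set.Iic Y, ENNReal.ofReal (t ^ b) ∂π ≤
      ENNReal.ofReal (Y ^ b) := by
    intro Y hY
    calc _ ≤ ∫⁻ _ in Set.Iic Y, ENNReal.ofReal (Y ^ b) ∂π := by
          refine lintegral_mono_ae ?_
          filter_upwards [ae_restrict_mem measurableSet_Iic,
            ae_restrict_of_ae (ae_pos_localPrior K a L)] with t ht ht0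
          have : t ≤ Y := ht
          exact ENNReal.ofReal_le_ofReal (Real.rpow_le_rpow ht0.le this hb0.le)
      _ ≤ _ := by
          rw [setLIntegral_const]
          exact mul_le_of_le_one_right' prob_le_one
  have hmeas : Measurable fun t : ℝ => ENNReal.ofReal (t ^ b) := by fun_prop
  have hbound : ∀ Y : ℝ, 0 < Y → ∫⁻ t in Set.Iic Y, ENNReal.ofReal (t ^ b) ∂π ≤
      ENNReal.ofReal (A + θ * A / (1 - θ)) := by
    intro Y hY
    set g : ℝ → ENNReal := (Set.Iic Y).indicator fun t => ENNReal.ofReal (t ^ b) with hg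
    have hgm : Measurable g := hmeas.indicator measurableSet_Iic
    set I : ENNReal := ∫⁻ t in Set.Ioi (2 * X₀), g t ∂π with hI
    have hIfin : I ≠ ⊤ := by
      refine ne_top_of_le_ne_top (b := ENNReal.ofReal (Y ^ b)) ENNReal.ofReal_ne_top ?_
      calc I ≤ ∫⁻ t, g t ∂π := setLIntegral_le_lintegral _ _
        _ = ∫⁻ t in Set.Iic Y, ENNReal.ofReal (t ^ b) ∂π := lintegral_indicator measurableSet_Iic _
        _ ≤ _ := hmom Y hY.le
    have hsplit : ∀ Z : ℝ, 0 ≤ Z → ∫⁻ t in Set.Ioi Z, g t ∂π ≤ ENNReal.ofReal A + I := by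
      intro Z hZ
      calc _ ≤ ∫⁻ t, g t ∂π := setLIntegral_le_lintegral _ _
        _ = (∫⁻ t in Set.Iic (2 * X₀), g t ∂π) + I := by
            rw [hI, ← lintegral_add_compl _ (measurableSet_Iic (a := 2 * X₀)), Set.compl_Iic]
        _ ≤ _ := by
            gcongr
            refine le_trans (lintegral_mono fun t => ?_) (hmom (2 * X₀) (by linarith))
            exact Set.indicator_le_self _ _ t
    have hscale : ∀ t ∈ Set.Ioi X₀, g (2 * t) ≤ ENNReal.ofReal (2 ^ b) * g t := by
      intro t ht
      have ht0 : 0 < t := lt_of_lt_of_le one_pos (hX1.trans (le_of_lt ht))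
      by_cases h : 2 * t ≤ Y
      · have h' : t ≤ Y := by linarith
        rw [hg, Set.indicator_of_mem (show 2 * t ∈ Set.Iic Y from h),
          Set.indicator_of_mem (show t ∈ Set.Iic Y from h'), Real.mul_rpow zero_le_two ht0.le,
          ENNReal.ofReal_mul (by positivity)]
      · rw [hg, Set.indicator_of_notMem (show 2 * t ∉ Set.Iic Y from h)]
        exact zero_le
    have hrec : I ≤ ENNReal.ofReal θ * (ENNReal.ofReal A + I) := by
      calc I ≤ _ := hX g hgm
        _ ≤ ENNReal.ofReal (2 ^ ((a - b) / 2) * 2 ^ (-a)) *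
            ∫⁻ t in Set.Ioi X₀, ENNReal.ofReal (2 ^ b) * g t ∂π := by
              gcongr 1
              exact setLIntegral_mono' measurableSet_Ioi hscale
        _ = ENNReal.ofReal θ * ∫⁻ t in Set.Ioi X₀, g t ∂π := by
              rw [lintegral_const_mul' _ _ ENNReal.ofReal_ne_top, ← mul_assoc,
                ← ENNReal.ofReal_mul (by positivity), hθ]
        _ ≤ _ := by
              gcongr
              exact hsplit X₀ (by linarith)
    have hI' : I.toReal ≤ θ * A / (1 - θ) := by
      have h := ENNReal.toReal_mono (by finiteness) hrec
      rw [ENNReal.toReal_mul, ENNReal.toReal_add ENNReal.ofReal_ne_top hIfin,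
        ENNReal.toReal_ofReal hθ0.le, ENNReal.toReal_ofReal hA0] at h
      rw [le_div_iff₀ (by linarith)]
      linarith
    calc _ = ∫⁻ t, g t ∂π := (lintegral_indicator measurableSet_Iic _).symm
      _ = ∫⁻ t in Set.Ioi 0, g t ∂π := by
          have h : ∀ᵐ t ∂π, t ∈ Set.Ioi 0 := ae_pos_localPrior K a L
          rw [Measure.restrict_eq_self_of_ae_mem h]
      _ ≤ _ := hsplit 0 le_rfl
      _ ≤ _ := by
          have h1 : 0 ≤ θ * A / (1 - θ) := div_nonneg (by positivity) (by linarith)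
          rw [ENNReal.ofReal_add hA0 h1]
          gcongr
          rw [← ENNReal.ofReal_toReal hIfin]
          exact ENNReal.ofReal_le_ofReal hI'
  refine (aecover_Iic tendsto_id).integrable_of_lintegral_enorm_bounded
    (A + θ * A / (1 - θ)) (by fun_prop) ?_
  filter_upwards [eventually_gt_atTop 0] with Y hY
  refine le_of_eq_of_le (lintegral_congr_ae ?_) (hbound Y hY)
  filter_upwards [ae_restrict_of_ae (ae_pos_localPrior K a L)] with t ht
  rw [Real.enorm_of_nonneg (by positivity)]

/-- The prior gives a block `(N, 4 N]` a mass that decays no faster than any power of `N` with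
exponent below `-a`. -/
lemma exists_le_localPrior_Ioc (hK : 0 < K) (hL : IsSlowlyVarying L)
    [IsProbabilityMeasure (localPrior K a L)] {b : ℝ} (hab : a < b) (hb : 0 < b) :
    ∃ c X₀ : ℝ, 0 < c ∧ 0 < X₀ ∧ ∀ N, X₀ ≤ N →
      c * N ^ (-b) ≤ (localPrior K a L).real (Set.Ioc N (4 * N)) := by
  set π := localPrior K a L with hπdef
  obtain ⟨X₀, hX1, hX⟩ := exists_le_setLIntegral_localPrior_two_mul (a := a) hK hL
    (r := 2 ^ (a - b)) (by positivity)
    (Real.rpow_lt_one_of_one_lt_of_neg one_lt_two (by linarith))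
  have hX0 : 0 < X₀ := by linarith
  have hr : (2 : ℝ) ^ (a - b) * 2 ^ (-a) = 2 ^ (-b) := by
    rw [← Real.rpow_add two_pos]
    congr 1
    ring
  rw [hr] at hX
  have hdouble : ∀ y, X₀ ≤ y →
      2 ^ (-b) * π.real (Set.Ioc y (2 * y)) ≤ π.real (Set.Ioc (2 * y) (2 * (2 * y))) := by
    intro y hy
    have h := hX ((Set.Ioc (2 * y) (2 * (2 * y))).indicator 1)
      (measurable_one.indicator measurableSet_Ioc)
    have h1 : ∀ t, (Set.Ioc (2 * y) (2 * (2 * y))).indicator (1 : ℝ → ENNReal) (2 * t) =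
        (Set.Ioc y (2 * y)).indicator 1 t := by
      intro t
      simp only [Set.indicator_apply, Set.mem_Ioc, mul_lt_mul_iff_right₀ (two_pos (α := ℝ)),
        mul_le_mul_iff_right₀ (two_pos (α := ℝ)), Pi.one_apply]
    simp only [h1] at h
    rw [lintegral_indicator_one measurableSet_Ioc, lintegral_indicator_one measurableSet_Ioc,
      Measure.restrict_apply measurableSet_Ioc, Measure.restrict_apply measurableSet_Ioc,
      Set.inter_eq_self_of_subset_left, Set.inter_eq_self_of_subset_left] at h
    · have h2 := ENNReal.toReal_mono (measure_ne_top _ _) h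
      rwa [ENNReal.toReal_mul, ENNReal.toReal_ofReal (by positivity)] at h2
    · exact fun t ht => lt_of_le_of_lt (by linarith) ht.1
    · exact fun t ht => lt_of_le_of_lt hy ht.1
  set c₀ := π.real (Set.Ioc X₀ (2 * X₀)) with hc₀
  have hc₀pos : 0 < c₀ := by
    rw [hc₀, measureReal_def, ENNReal.toReal_pos_iff]
    refine ⟨pos_iff_ne_zero.2 fun h => ?_, measure_lt_top _ _⟩
    rw [hπdef, localPrior, withDensity_apply_eq_zero' (aemeasurable_localPrior_density hL)] at h
    have hsub : Set.Ioc X₀ (2 * X₀) ⊆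
        {t | ENNReal.ofReal (K * t ^ (-a - 1) * L t) ≠ 0} ∩ Set.Ioc X₀ (2 * X₀) := by
      intro t ht
      refine ⟨?_, ht⟩
      have ht0 : 0 < t := hX0.trans ht.1
      have := hL.pos t ht0
      exact (ENNReal.ofReal_pos.2 (by positivity)).ne'
    have h2 := measure_mono_null hsub h
    have hpos : Set.Ioc X₀ (2 * X₀) ⊆ Set.Ioi 0 := fun t ht => hX0.trans ht.1
    rw [Measure.restrict_apply measurableSet_Ioc, Set.inter_eq_self_of_subset_left hpos,
      Real.volume_Ioc, ENNReal.ofReal_eq_zero] at h2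
    linarith
  have hiter : ∀ n : ℕ, (2 ^ n : ℝ) ^ (-b) * c₀ ≤
      π.real (Set.Ioc (2 ^ n * X₀) (2 * (2 ^ n * X₀))) := by
    intro n
    induction n with
    | zero => simp [hc₀]
    | succ n ih =>
      have hle : X₀ ≤ 2 ^ n * X₀ := le_mul_of_one_le_left hX0.le (one_le_pow₀ one_le_two)
      have h := hdouble _ hle
      have e : (2 : ℝ) ^ (n + 1) * X₀ = 2 * (2 ^ n * X₀) := by ring
      rw [e, pow_succ', Real.mul_rpow zero_le_two (by positivity), mul_assoc]
      exact (mul_le_mul_of_nonneg_left ih (by positivity)).trans h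
  refine ⟨(2 / X₀) ^ (-b) * c₀, X₀, by positivity, hX0, fun N hN => ?_⟩
  have hN0 : 0 < N := hX0.trans_le hN
  obtain ⟨n, h1, h2⟩ := exists_nat_pow_near ((one_le_div hX0).2 hN) one_lt_two
  rw [le_div_iff₀ hX0] at h1
  rw [div_lt_iff₀ hX0] at h2
  calc _ = (2 / X₀ * N) ^ (-b) * c₀ := by
        rw [Real.mul_rpow (by positivity) hN0.le]
        ring
    _ ≤ (2 ^ (n + 1) : ℝ) ^ (-b) * c₀ := by
        gcongr 1
        refine Real.rpow_le_rpow_of_nonpos (by positivity) ?_ (by linarith)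
        rw [pow_succ, div_mul_eq_mul_div, le_div_iff₀ hX0]
        linarith
    _ ≤ _ := hiter (n + 1)
    _ ≤ _ := by
        refine measureReal_mono (Set.Ioc_subset_Ioc h2.le ?_)
        rw [pow_succ]
        linarith

end Prior

/-! ### The prior mass of signals -/

lemma log_one_div_sq (τ : ℝ) : Real.log (1 / τ ^ 2) = -2 * Real.log τ := by
  rw [one_div, Real.log_inv, Real.log_pow]
  push_cast
  ring

lemma tendsto_log_one_div_sq :
    Tendsto (fun τ : ℝ => Real.log (1 / τ ^ 2)) (𝓝[>] 0) atTop := by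
  simp only [log_one_div_sq]
  exact Real.tendsto_log_nhdsGT_zero.const_mul_atBot_of_neg (by norm_num)

lemma tendsto_rpow_nhdsGT_zero {s : ℝ} (hs : 0 < s) :
    Tendsto (fun τ : ℝ => τ ^ s) (𝓝[>] 0) (𝓝 0) := by
  have h := (Real.continuousAt_rpow_const 0 s (Or.inr hs.le)).tendsto
  rw [Real.zero_rpow hs.ne'] at h
  exact h.mono_left nhdsWithin_le_nhds

lemma one_sub_shrinkage_mul_sqrt_le {t : ℝ} (ht : 0 < t) (τ : ℝ) :
    (1 - shrinkage τ t) * √(shrinkage τ t) ≤ t * τ ^ 2 := by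
  have h1 := shrinkage_pos ht τ
  have h2 := shrinkage_le_one ht τ
  calc _ ≤ 1 - shrinkage τ t :=
        mul_le_of_le_one_right (sub_nonneg.2 h2) (Real.sqrt_le_one.2 h2)
    _ ≤ _ := by
      have h3 : 0 ≤ t * τ ^ 2 := by positivity
      rw [shrinkage, one_sub_div (by positivity), div_le_iff₀ (by positivity)]
      nlinarith

lemma one_sub_shrinkage_mul_sqrt_le_one {t : ℝ} (ht : 0 < t) (τ : ℝ) :
    (1 - shrinkage τ t) * √(shrinkage τ t) ≤ 1 := by
  have h1 := shrinkage_pos ht τ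
  have h2 := shrinkage_le_one ht τ
  exact mul_le_one₀ (by linarith) (Real.sqrt_nonneg _) (Real.sqrt_le_one.2 h2)

lemma one_sub_shrinkage_mul_sqrt_le_inv {τ t : ℝ} (hτ : 0 < τ) (ht : 0 < t) :
    (1 - shrinkage τ t) * √(shrinkage τ t) ≤ 1 / (√t * τ) := by
  have h1 := shrinkage_pos ht τ
  have h2 := shrinkage_le_one ht τ
  calc _ ≤ √(shrinkage τ t) := mul_le_of_le_one_left (Real.sqrt_nonneg _) (by linarith)
    _ ≤ √(1 / (t * τ ^ 2)) := by
      unfold shrinkage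
      gcongr
      linarith
    _ = _ := by
      rw [Real.sqrt_div zero_le_one, Real.sqrt_one, Real.sqrt_mul ht.le, Real.sqrt_sq hτ.le]

/-- `(1 - κ) √κ ≤ min (t τ²) 1 ≤ (t τ²) ^ b`. -/
lemma signalMass_le_rpow {π : Measure ℝ} [IsProbabilityMeasure π] (hπ : ∀ᵐ t ∂π, 0 < t) {b : ℝ}
    (hb0 : 0 < b) (hb1 : b ≤ 1) (hint : Integrable (fun t => t ^ b) π) {τ : ℝ} (hτ : 0 < τ) :
    signalMass π τ ≤ τ ^ (2 * b) * ∫ t, t ^ b ∂π := by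
  rw [signalMass, ← integral_const_mul]
  refine integral_mono_ae (integrable_signalMass hπ τ) (hint.const_mul _) ?_
  filter_upwards [hπ] with t ht
  have hs : 0 < t * τ ^ 2 := by positivity
  have he : (t * τ ^ 2) ^ b = τ ^ (2 * b) * t ^ b := by
    rw [Real.mul_rpow ht.le (by positivity), ← Real.rpow_natCast_mul hτ.le, mul_comm]
    simp
  rw [← he]
  rcases le_total (t * τ ^ 2) 1 with h | h
  · refine (one_sub_shrinkage_mul_sqrt_le ht τ).trans ?_
    simpa using Real.rpow_le_rpow_of_exponent_ge hs h hb1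
  · exact (one_sub_shrinkage_mul_sqrt_le_one ht τ).trans (Real.one_le_rpow h hb0.le)

section Prior

variable {K a : ℝ} {L : ℝ → ℝ}

lemma sqrt_log_le {N t : ℝ} (hN : Real.exp 1 ≤ N) (ht : N ≤ t) :
    √(Real.log t) ≤ √(Real.log N) * √(t / N) := by
  have hN0 : 0 < N := (Real.exp_pos 1).trans_le hN
  have ht0 : 0 < t := hN0.trans_le ht
  have hlog : 0 ≤ Real.log N := Real.log_nonneg ((Real.one_le_exp zero_le_one).trans hN)
  rw [← Real.sqrt_mul hlog]
  refine Real.sqrt_le_sqrt ?_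
  have h := Real.log_div_self_antitoneOn hN (hN.trans ht) ht
  rw [div_le_div_iff₀ ht0 hN0] at h
  rw [mul_div_assoc', le_div_iff₀ hN0]
  linarith

/-- The integrand, times `√(log (1 / τ²))`, majorizes
`t ^ (-3/2) √(log t) min (t τ²) (1 / (√t τ))`, which in turn dominates the prior density times
`(1 - κ) √κ` when `a = 1/2`, up to a constant. -/
lemma integral_majorant {τ : ℝ} (hτ : 0 < τ) :
    IntegrableOn (fun t : ℝ => if t ≤ 1 / τ ^ 2 then τ ^ 2 * t ^ (-1 / 2 : ℝ)
      else t ^ (-3 / 2 : ℝ)) (Set.Ioi 0) ∧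
    ∫ t in Set.Ioi 0, (if t ≤ 1 / τ ^ 2 then τ ^ 2 * t ^ (-1 / 2 : ℝ) else t ^ (-3 / 2 : ℝ)) =
      4 * τ := by
  have hN : 0 < 1 / τ ^ 2 := by positivity
  have e1 : Set.EqOn (fun t : ℝ => if t ≤ 1 / τ ^ 2 then τ ^ 2 * t ^ (-1 / 2 : ℝ)
      else t ^ (-3 / 2 : ℝ)) (fun t => τ ^ 2 * t ^ (-1 / 2 : ℝ)) (Set.Ioc 0 (1 / τ ^ 2)) :=
    fun t ht => if_pos ht.2
  have e2 : Set.EqOn (fun t : ℝ => if t ≤ 1 / τ ^ 2 then τ ^ 2 * t ^ (-1 / 2 : ℝ)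
      else t ^ (-3 / 2 : ℝ)) (fun t => t ^ (-3 / 2 : ℝ)) (Set.Ioi (1 / τ ^ 2)) :=
    fun t ht => if_neg (not_le.2 ht)
  have i1 : IntegrableOn (fun t : ℝ => τ ^ 2 * t ^ (-1 / 2 : ℝ)) (Set.Ioc 0 (1 / τ ^ 2)) := by
    refine Integrable.const_mul ?_ _
    exact (intervalIntegrable_iff_integrableOn_Ioc_of_le hN.le).1
      (intervalIntegral.intervalIntegrable_rpow' (by norm_num))
  have i2 : IntegrableOn (fun t : ℝ => t ^ (-3 / 2 : ℝ)) (Set.Ioi (1 / τ ^ 2)) :=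
    integrableOn_Ioi_rpow_of_lt (by norm_num) hN
  have j1 := i1.congr_fun e1.symm measurableSet_Ioc
  have j2 := i2.congr_fun e2.symm measurableSet_Ioi
  have hpow : (1 / τ ^ 2) ^ (1 / 2 : ℝ) = 1 / τ := by
    rw [← Real.sqrt_eq_rpow, Real.sqrt_div zero_le_one, Real.sqrt_one, Real.sqrt_sq hτ.le]
  rw [← Set.Ioc_union_Ioi_eq_Ioi hN.le]
  refine ⟨j1.union j2, ?_⟩
  rw [setIntegral_union (Set.Ioc_disjoint_Ioi le_rfl) measurableSet_Ioi j1 j2,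
    setIntegral_congr_fun measurableSet_Ioc e1, setIntegral_congr_fun measurableSet_Ioi e2,
    integral_const_mul, ← intervalIntegral.integral_of_le hN.le,
    integral_rpow (Or.inl (by norm_num)), integral_Ioi_rpow_of_lt (by norm_num) hN]
  have h1 : (-1 / 2 + 1 : ℝ) = 1 / 2 := by norm_num
  have h2 : (-3 / 2 + 1 : ℝ) = -(1 / 2) := by norm_num
  rw [h1, h2, Real.rpow_neg hN.le, hpow, Real.zero_rpow (by norm_num)]
  field_simp
  norm_num

/-- The case `a = 1/2`: a bound `L t ≤ ε √(log t)` for `t > T` bounds the signal mass. -/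
lemma signalMass_le_of_le_sqrt_log (hK : 0 < K) (hL : IsSlowlyVarying L)
    [IsProbabilityMeasure (localPrior K (1 / 2) L)] {ε T : ℝ} (hε : 0 < ε) (hT : 0 < T)
    (hLT : ∀ t, T < t → L t ≤ ε * √(Real.log t)) {τ : ℝ} (hτ : 0 < τ)
    (hτe : Real.exp 1 ≤ 1 / τ ^ 2) :
    signalMass (localPrior K (1 / 2) L) τ ≤
      T * τ ^ 2 + K * ε * √(Real.log (1 / τ ^ 2)) * (4 * τ) := by
  set π := localPrior K (1 / 2) L with hπdef
  have hπ : ∀ᵐ t ∂π, 0 < t := ae_pos_localPrior K (1 / 2) L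
  set N : ℝ := 1 / τ ^ 2 with hN
  have hN0 : 0 < N := by positivity
  set w : ℝ → ℝ := fun t => (1 - shrinkage τ t) * √(shrinkage τ t) with hw
  have hwm : Measurable w := by
    have := measurable_shrinkage τ
    fun_prop
  set M : ℝ → ℝ := fun t => if t ≤ N then τ ^ 2 * t ^ (-1 / 2 : ℝ) else t ^ (-3 / 2 : ℝ) with hM
  obtain ⟨hMi, hMint⟩ := integral_majorant hτ
  have hM0 : ∀ t, 0 < t → 0 ≤ M t := by
    intro t ht
    simp only [hM]
    split_ifs <;> positivity
  have hlow : ∫⁻ t in Set.Iic T, ENNReal.ofReal (w t) ∂π ≤ ENNReal.ofReal (T * τ ^ 2) := by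
    calc _ ≤ ∫⁻ _ in Set.Iic T, ENNReal.ofReal (T * τ ^ 2) ∂π := by
          refine lintegral_mono_ae ?_
          filter_upwards [ae_restrict_mem measurableSet_Iic, ae_restrict_of_ae hπ] with t ht ht0
          have : t ≤ T := ht
          refine ENNReal.ofReal_le_ofReal ((one_sub_shrinkage_mul_sqrt_le ht0 τ).trans ?_)
          gcongr
      _ ≤ _ := by
          rw [setLIntegral_const]
          exact mul_le_of_le_one_right' prob_le_one
  have hpt : ∀ t, T < t → K * t ^ (-(1 / 2) - 1 : ℝ) * L t * w t ≤
      K * ε * √(Real.log N) * M t := by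
    intro t ht
    have ht0 : 0 < t := hT.trans ht
    have hw0 : 0 ≤ w t := one_sub_shrinkage_mul_sqrt_nonneg ht0 τ
    have hexp : (-(1 / 2) - 1 : ℝ) = -3 / 2 := by norm_num
    rw [hexp]
    have h1 : K * t ^ (-3 / 2 : ℝ) * L t * w t ≤
        K * t ^ (-3 / 2 : ℝ) * (ε * √(Real.log t)) * w t := by
      gcongr
      exact hLT t ht
    refine h1.trans ?_
    by_cases htN : t ≤ N
    · have h2 : √(Real.log t) ≤ √(Real.log N) := Real.sqrt_le_sqrt (Real.log_le_log ht0 htN)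
      have h3 : t ^ (-3 / 2 : ℝ) * t = t ^ (-1 / 2 : ℝ) := by
        rw [← Real.rpow_add_one ht0.ne']
        norm_num
      simp only [hM, if_pos htN]
      calc _ ≤ K * t ^ (-3 / 2 : ℝ) * (ε * √(Real.log N)) * (t * τ ^ 2) := by
            gcongr
            exact one_sub_shrinkage_mul_sqrt_le ht0 τ
        _ = K * ε * √(Real.log N) * (τ ^ 2 * (t ^ (-3 / 2 : ℝ) * t)) := by ring
        _ = _ := by rw [h3]
    · have h2 := sqrt_log_le hτe (not_le.1 htN).le
      have h3 : √(t / N) * (1 / (√t * τ)) = 1 := by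
        rw [hN, div_div_eq_mul_div, div_one, Real.sqrt_mul ht0.le, Real.sqrt_sq hτ.le]
        have : 0 < √t := Real.sqrt_pos.2 ht0
        field_simp
      simp only [hM, if_neg htN]
      calc _ ≤ K * t ^ (-3 / 2 : ℝ) * (ε * (√(Real.log N) * √(t / N))) * (1 / (√t * τ)) := by
            gcongr
            exact one_sub_shrinkage_mul_sqrt_le_inv hτ ht0
        _ = K * ε * √(Real.log N) * t ^ (-3 / 2 : ℝ) * (√(t / N) * (1 / (√t * τ))) := by ring
        _ = _ := by rw [h3, mul_one]
  have hhigh : ∫⁻ t in Set.Ioi T, ENNReal.ofReal (w t) ∂π ≤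
      ENNReal.ofReal (K * ε * √(Real.log N) * (4 * τ)) := by
    rw [hπdef, setLIntegral_localPrior hL (by fun_prop) hT.le]
    calc _ ≤ ∫⁻ t in Set.Ioi T, ENNReal.ofReal (K * ε * √(Real.log N) * M t) := by
          refine setLIntegral_mono' measurableSet_Ioi fun t ht => ?_
          have ht' : T < t := ht
          have ht0 : 0 < t := hT.trans ht'
          have := hL.pos t ht0
          rw [← ENNReal.ofReal_mul (by positivity)]
          exact ENNReal.ofReal_le_ofReal (hpt t ht')
      _ ≤ ∫⁻ t in Set.Ioi 0, ENNReal.ofReal (K * ε * √(Real.log N) * M t) :=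
          lintegral_mono_set (Set.Ioi_subset_Ioi hT.le)
      _ = _ := by
          rw [← ofReal_integral_eq_lintegral_ofReal (hMi.const_mul _), integral_const_mul, hMint]
          filter_upwards [ae_restrict_mem measurableSet_Ioi] with t ht
          have := hM0 t ht
          positivity
  have htot : ENNReal.ofReal (signalMass π τ) ≤
      ENNReal.ofReal (T * τ ^ 2 + K * ε * √(Real.log N) * (4 * τ)) := by
    rw [signalMass, ofReal_integral_eq_lintegral_ofReal (integrable_signalMass hπ τ),
      ENNReal.ofReal_add (by positivity) (by positivity),
      ← lintegral_add_compl _ (measurableSet_Iic (a := T)), Set.compl_Iic]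
    · exact add_le_add hlow hhigh
    · filter_upwards [hπ] with t ht using one_sub_shrinkage_mul_sqrt_nonneg ht τ
  exact (ENNReal.ofReal_le_ofReal_iff (by positivity)).1 htot

/-- The signal mass is `o(τ √(log (1 / τ²)))`; this is where the hypotheses on `a` and `L` enter. -/
lemma eventually_signalMass_le (hK : 0 < K) (hL : IsSlowlyVarying L)
    [IsProbabilityMeasure (localPrior K a L)]
    (ha : (1 / 2 < a ∧ a < 1) ∨
      (a = 1 / 2 ∧ Tendsto (fun t => L t / √(Real.log t)) atTop (𝓝 0))) {ε : ℝ} (hε : 0 < ε) :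
    ∀ᶠ τ in 𝓝[>] (0 : ℝ), signalMass (localPrior K a L) τ ≤ ε * (τ * √(Real.log (1 / τ ^ 2))) := by
  have hlog1 := tendsto_log_one_div_sq.eventually_ge_atTop 1
  rcases ha with ⟨ha1, ha2⟩ | ⟨rfl, hlim⟩
  · obtain ⟨b, hb1, hb2⟩ := exists_between ha1
    have hint := integrable_rpow_localPrior hK hL (by linarith) hb2
    have hlim := (tendsto_rpow_nhdsGT_zero (by linarith : 0 < 2 * b - 1)).mul_const
      (∫ t, t ^ b ∂(localPrior K a L))
    rw [zero_mul] at hlim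
    filter_upwards [hlim.eventually (gt_mem_nhds hε), hlog1, self_mem_nhdsWithin]
      with τ h1 h2 hτ
    have hτ0 : 0 < τ := hτ
    have h3 : 1 ≤ √(Real.log (1 / τ ^ 2)) := Real.one_le_sqrt.2 h2
    refine (signalMass_le_rpow (ae_pos_localPrior K a L) (by linarith) (by linarith) hint
      hτ0).trans ?_
    have h4 : τ ^ (2 * b) = τ * τ ^ (2 * b - 1) := by
      rw [Real.rpow_sub_one hτ0.ne']
      field_simp
    calc _ = τ * (τ ^ (2 * b - 1) * ∫ t, t ^ b ∂(localPrior K a L)) := by rw [h4]; ring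
      _ ≤ τ * ε * 1 := by rw [mul_one]; gcongr
      _ ≤ τ * ε * √(Real.log (1 / τ ^ 2)) := by gcongr
      _ = _ := by ring
  · have hε' : 0 < ε / (8 * K) := by positivity
    obtain ⟨T, hT⟩ := eventually_atTop.1
      ((hlim.eventually (gt_mem_nhds hε')).and (eventually_gt_atTop 1))
    have hT1 : 1 < T := (hT T le_rfl).2
    have hLT : ∀ t, T < t → L t ≤ ε / (8 * K) * √(Real.log t) := by
      intro t ht
      have h := (hT t ht.le).1
      have hpos : 0 < √(Real.log t) := Real.sqrt_pos.2 (Real.log_pos (hT1.trans ht))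
      rw [div_lt_iff₀ hpos] at h
      exact h.le
    have hlin : Tendsto (fun τ : ℝ => T * τ) (𝓝[>] 0) (𝓝 0) := by
      have : Tendsto (fun τ : ℝ => T * τ) (𝓝 0) (𝓝 (T * 0)) := by
        exact (continuous_const.mul continuous_id).tendsto 0
      rw [mul_zero] at this
      exact this.mono_left nhdsWithin_le_nhds
    filter_upwards [hlin.eventually (gt_mem_nhds (half_pos hε)), hlog1, self_mem_nhdsWithin]
      with τ h1 h2 hτ
    have hτ0 : 0 < τ := hτ
    have h3 : 1 ≤ √(Real.log (1 / τ ^ 2)) := Real.one_le_sqrt.2 h2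
    refine (signalMass_le_of_le_sqrt_log hK hL hε' (by linarith) hLT hτ0
      ((Real.le_log_iff_exp_le (by positivity)).1 h2)).trans ?_
    calc _ = T * τ * τ * 1 + ε / 2 * (τ * √(Real.log (1 / τ ^ 2))) := by
          field_simp
          ring
      _ ≤ ε / 2 * τ * √(Real.log (1 / τ ^ 2)) + ε / 2 * (τ * √(Real.log (1 / τ ^ 2))) := by
          gcongr
      _ = _ := by ring

end Prior

/-! ### The rejection region of the one-group rule -/

/-- The observations at which the one-group rule with prior law `π` for `λ²` rejects. -/
def rejectionRegion (π : Measure ℝ) (τ : ℝ) : Set ℝ := {x | 1 / 2 < 1 - posteriorShrinkage π τ x}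

lemma measurableSet_rejectionRegion (π : Measure ℝ) [IsProbabilityMeasure π] (τ : ℝ) :
    MeasurableSet (rejectionRegion π τ) :=
  measurableSet_lt measurable_const (measurable_const.sub (measurable_posteriorShrinkage τ))

lemma exp_mul_log_one_div_sq {τ : ℝ} (hτ : 0 < τ) (B : ℝ) :
    Real.exp (B * Real.log (1 / τ ^ 2) / 2) = τ ^ (-B) := by
  rw [Real.rpow_def_of_pos hτ, log_one_div_sq]
  ring_nf

section Prior

variable {K a : ℝ} {L : ℝ → ℝ}

/-- The type I error probability is `o(τ)`: the signal mass forces `x² > -2 log (ε τ √ℓ)` with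
`ℓ = log (1 / τ²)` on the rejection region, and the factor `√ℓ` is cancelled by Mills' bound. -/
lemma tendsto_gaussianReal_rejectionRegion_div (hK : 0 < K) (hL : IsSlowlyVarying L)
    [IsProbabilityMeasure (localPrior K a L)]
    (ha : (1 / 2 < a ∧ a < 1) ∨
      (a = 1 / 2 ∧ Tendsto (fun t => L t / √(Real.log t)) atTop (𝓝 0))) :
    Tendsto (fun τ => (gaussianReal 0 1).real (rejectionRegion (localPrior K a L) τ) / τ)
      (𝓝[>] 0) (𝓝 0) := by
  set π := localPrior K a L with hπdef
  have hπ : ∀ᵐ t ∂π, 0 < t := ae_pos_localPrior K a L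
  set g := ∫ t, √(shrinkage 1 t) ∂π with hg
  have hg0 : 0 < g := integral_sqrt_shrinkage_pos hπ 1
  have key : ∀ ε > 0, ∀ᶠ τ in 𝓝[>] (0 : ℝ),
      (gaussianReal 0 1).real (rejectionRegion π τ) / τ ≤ 4 * ε := by
    intro ε hε
    have hlogε : ∀ᶠ y in atTop, Real.log y ≤ 1 / 2 * y := by
      filter_upwards [Real.isLittleO_log_id_atTop.bound (by norm_num : (0 : ℝ) < 1 / 2),
        eventually_ge_atTop 0] with y hy hy0
      simpa [abs_of_nonneg hy0] using (le_abs_self _).trans hy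
    filter_upwards [eventually_signalMass_le hK hL ha (by positivity : 0 < ε * g / 2),
      tendsto_log_one_div_sq.eventually hlogε,
      tendsto_log_one_div_sq.eventually_ge_atTop (8 * Real.log ε),
      tendsto_log_one_div_sq.eventually_gt_atTop 0,
      Ioc_mem_nhdsGT (zero_lt_one : (0 : ℝ) < 1)] with τ h1 h2 h3 h4 hτ
    obtain ⟨hτ0, hτ1⟩ := hτ
    set ℓ := Real.log (1 / τ ^ 2) with hℓ
    set Q := ε * (τ * √ℓ) with hQ
    have hQ0 : 0 < Q := by positivity
    have hlogQ : -2 * Real.log Q = ℓ - Real.log ℓ - 2 * Real.log ε := by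
      rw [hQ, Real.log_mul hε.ne' (by positivity), Real.log_mul hτ0.ne' (by positivity),
        Real.log_sqrt h4.le, hℓ, log_one_div_sq]
      ring
    set s := -2 * Real.log Q with hs
    have hs4 : ℓ / 4 ≤ s := by linarith
    have hs0 : 0 < s := by linarith
    have hsub : rejectionRegion π τ ⊆ {x | s < x ^ 2} := by
      intro x hx
      have hx' : 1 / 2 < 1 - posteriorShrinkage π τ x := hx
      by_contra hle
      have hle' : x ^ 2 ≤ s := not_lt.1 hle
      have h5 := one_sub_posteriorShrinkage_le hπ hτ0 hτ1 x
      have h6 : Real.exp (x ^ 2 / 2) * signalMass π τ / g ≤ 1 / 2 := by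
        rw [div_le_iff₀ hg0]
        calc _ ≤ Real.exp (x ^ 2 / 2) * (ε * g / 2 * (τ * √ℓ)) := by gcongr
          _ ≤ Real.exp (-Real.log Q) * (ε * g / 2 * (τ * √ℓ)) := by
              gcongr
              linarith
          _ = Q⁻¹ * Q * (g / 2) := by
              rw [Real.exp_neg, Real.exp_log hQ0, hQ]
              ring
          _ = _ := by
              rw [inv_mul_cancel₀ hQ0.ne']
              ring
      linarith
    rw [div_le_iff₀ hτ0]
    have h7 : √ℓ / 2 ≤ √s := by
      refine Real.le_sqrt_of_sq_le ?_
      rw [div_pow, Real.sq_sqrt h4.le]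
      linarith
    have h8 : Real.exp (-s / 2) = Q := by
      rw [hs, show -(-2 * Real.log Q) / 2 = Real.log Q by ring, Real.exp_log hQ0]
    have h9 : 0 < √ℓ := Real.sqrt_pos.2 h4
    calc _ ≤ _ := measureReal_mono hsub
      _ ≤ 2 * (Real.exp (-s / 2) / √s) := gaussianReal_lt_sq_le hs0
      _ ≤ 2 * (Q / (√ℓ / 2)) := by rw [h8]; gcongr
      _ = _ := by rw [hQ]; field_simp; norm_num
  refine Metric.tendsto_nhds.2 fun ε hε => ?_
  filter_upwards [key (ε / 8) (by positivity), self_mem_nhdsWithin] with τ h hτ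
  have hτ0 : 0 < τ := hτ
  rw [Real.dist_eq, sub_zero, abs_of_nonneg (by positivity)]
  linarith

/-- Observations with `x² ≤ B log (1 / τ²)`, `B < 2 a`, are eventually not rejected. -/
lemma eventually_subset_compl_rejectionRegion (hK : 0 < K) (hL : IsSlowlyVarying L)
    [IsProbabilityMeasure (localPrior K a L)] (ha0 : 0 < a) (ha1 : a < 1) {B : ℝ} (hB : B < 2 * a) :
    ∀ᶠ τ in 𝓝[>] (0 : ℝ), {x | x ^ 2 ≤ B * Real.log (1 / τ ^ 2)} ⊆
      (rejectionRegion (localPrior K a L) τ)ᶜ := by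
  set π := localPrior K a L with hπdef
  have hπ : ∀ᵐ t ∂π, 0 < t := ae_pos_localPrior K a L
  set g := ∫ t, √(shrinkage 1 t) ∂π with hg
  have hg0 : 0 < g := integral_sqrt_shrinkage_pos hπ 1
  obtain ⟨b, hb1, hb2⟩ := exists_between (max_lt (by linarith : B / 2 < a) ha0)
  have hbB : B / 2 < b := (le_max_left _ _).trans_lt hb1
  have hb0 : 0 < b := (le_max_right _ _).trans_lt hb1
  have hint := integrable_rpow_localPrior hK hL hb0 hb2
  have hlim := (tendsto_rpow_nhdsGT_zero (by linarith : 0 < 2 * b - B)).mul_const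
    ((∫ t, t ^ b ∂π) / g)
  rw [zero_mul] at hlim
  filter_upwards [hlim.eventually (gt_mem_nhds (by norm_num : (0 : ℝ) < 1 / 2)),
    Ioc_mem_nhdsGT (zero_lt_one : (0 : ℝ) < 1)] with τ h1 hτ x hx
  obtain ⟨hτ0, hτ1⟩ := hτ
  have hx' : x ^ 2 ≤ B * Real.log (1 / τ ^ 2) := hx
  have hM0 : 0 ≤ ∫ t, t ^ b ∂π := integral_nonneg_of_ae <| by
    filter_upwards [hπ] with t ht
    exact Real.rpow_nonneg ht.le _
  have h2 := one_sub_posteriorShrinkage_le hπ hτ0 hτ1 x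
  have h3 : Real.exp (x ^ 2 / 2) * signalMass π τ / g ≤
      τ ^ (2 * b - B) * ((∫ t, t ^ b ∂π) / g) := by
    calc _ ≤ Real.exp (B * Real.log (1 / τ ^ 2) / 2) * (τ ^ (2 * b) * ∫ t, t ^ b ∂π) / g := by
          have h4 := signalMass_nonneg hπ τ
          have h5 := signalMass_le_rpow hπ hb0 (by linarith) hint hτ0
          gcongr
      _ = _ := by
          rw [exp_mul_log_one_div_sq hτ0, sub_eq_neg_add, Real.rpow_add hτ0]
          ring
  change ¬ 1 / 2 < 1 - posteriorShrinkage π τ x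
  linarith

/-- Observations with `x² > B log (1 / τ²)` are eventually rejected, if `B > 2 a / ρ` for some
`ρ < 1/2`. -/
lemma eventually_subset_rejectionRegion (hK : 0 < K) (hL : IsSlowlyVarying L)
    [IsProbabilityMeasure (localPrior K a L)] (ha0 : 0 < a) {ρ B : ℝ} (hρ0 : 0 < ρ)
    (hρ : ρ < 1 / 2) (hB : 2 * a < ρ * B) :
    ∀ᶠ τ in 𝓝[>] (0 : ℝ), {x | B * Real.log (1 / τ ^ 2) < x ^ 2} ⊆
      rejectionRegion (localPrior K a L) τ := by
  set π := localPrior K a L with hπdef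
  have hπ : ∀ᵐ t ∂π, 0 < t := ae_pos_localPrior K a L
  set q' : ℝ := (1 / 2 - ρ) / 2 with hq'
  have hq'0 : 0 < q' := by linarith
  obtain ⟨b, hb1, hb2⟩ := exists_between (by linarith : a < ρ * B / 2)
  have hb0 : 0 < b := ha0.trans hb1
  obtain ⟨c, X₀, hc, hX₀, hmass⟩ := exists_le_localPrior_Ioc hK hL hb1 hb0
  set d : ℝ := √(1 / (1 + 4 / q')) * (c * (1 / q') ^ (-b)) with hd
  have hd0 : 0 < d := by positivity
  have hlim := (tendsto_rpow_nhdsGT_zero (by linarith : 0 < ρ * B - 2 * b)).mul_const (1 / d)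
  rw [zero_mul] at hlim
  have hN : Tendsto (fun τ : ℝ => 1 / q' * (1 / τ ^ 2)) (𝓝[>] 0) atTop := by
    refine Tendsto.const_mul_atTop (by positivity) ?_
    have h : Tendsto (fun τ : ℝ => τ⁻¹ ^ 2) (𝓝[>] 0) atTop :=
      (tendsto_pow_atTop two_ne_zero).comp tendsto_inv_nhdsGT_zero
    simpa using h
  filter_upwards [hlim.eventually (gt_mem_nhds hq'0), hN.eventually_ge_atTop X₀,
    self_mem_nhdsWithin] with τ h1 h2 hτ x hx
  have hτ0 : 0 < τ := hτ
  have hx' : B * Real.log (1 / τ ^ 2) < x ^ 2 := hx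
  set N : ℝ := 1 / q' * (1 / τ ^ 2) with hNdef
  have hN0 : 0 < N := by positivity
  have hNτ : N * τ ^ 2 = 1 / q' := by
    rw [hNdef]
    field_simp
  -- on `(N, 4 N]` the coefficient `κ` is at most `q'` and bounded below
  have hsub : Set.Ioc N (4 * N) ⊆ {t | shrinkage τ t ≤ q'} := by
    intro t ht
    have h3 : 1 / q' ≤ t * τ ^ 2 := by
      rw [← hNτ]
      have := ht.1.le
      gcongr
    change 1 / (1 + t * τ ^ 2) ≤ q'
    rw [div_le_iff₀ (by have : 0 < 1 / q' := by positivity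
                        linarith)]
    rw [div_le_iff₀ hq'0] at h3
    linarith
  have hlow : d * τ ^ (2 * b) ≤ ∫ t in {t | shrinkage τ t ≤ q'}, √(shrinkage τ t) ∂π := by
    have hint := integrable_sqrt_shrinkage hπ τ
    have hpow : N ^ (-b) = (1 / q') ^ (-b) * τ ^ (2 * b) := by
      have h3 : (1 / τ ^ 2) ^ (-b) = τ ^ (2 * b) := by
        rw [one_div, Real.rpow_neg (by positivity), Real.inv_rpow (by positivity), inv_inv,
          ← Real.rpow_natCast_mul hτ0.le]
        norm_num
      rw [hNdef, Real.mul_rpow (by positivity) (by positivity), h3]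
    calc _ = √(1 / (1 + 4 / q')) * (c * N ^ (-b)) := by rw [hpow, hd]; ring
      _ ≤ √(1 / (1 + 4 / q')) * π.real (Set.Ioc N (4 * N)) := by
          gcongr
          exact hmass N h2
      _ = ∫ _ in Set.Ioc N (4 * N), √(1 / (1 + 4 / q')) ∂π := by
          rw [setIntegral_const, smul_eq_mul, mul_comm]
      _ ≤ ∫ t in Set.Ioc N (4 * N), √(shrinkage τ t) ∂π := by
          refine setIntegral_mono_on (integrable_const _).integrableOn hint.integrableOn
            measurableSet_Ioc fun t ht => ?_
          have ht0 : 0 < t := hN0.trans ht.1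
          have h3 : t * τ ^ 2 ≤ 4 / q' := by
            calc _ ≤ 4 * N * τ ^ 2 := by
                  have := ht.2
                  gcongr
              _ = 4 * (N * τ ^ 2) := by ring
              _ = _ := by rw [hNτ]; ring
          unfold shrinkage
          gcongr
      _ ≤ _ := setIntegral_mono_set hint.integrableOn
          (Eventually.of_forall fun t => Real.sqrt_nonneg _) hsub.eventuallyLE
  have hq : 0 ≤ ρ + q' := by linarith
  have h4 := posteriorShrinkage_le hπ hq (by positivity) hlow x
  have h5 : Real.exp (-((ρ + q' - q') * x ^ 2 / 2)) / (d * τ ^ (2 * b)) < q' := by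
    refine lt_of_le_of_lt ?_ h1
    have h6 : Real.exp (-((ρ + q' - q') * x ^ 2 / 2)) ≤ τ ^ (ρ * B) := by
      have h7 := exp_mul_log_one_div_sq hτ0 (-(ρ * B))
      rw [neg_neg] at h7
      rw [← h7, Real.exp_le_exp]
      have := mul_le_mul_of_nonneg_left hx'.le hρ0.le
      linarith
    calc _ ≤ τ ^ (ρ * B) / (d * τ ^ (2 * b)) := by gcongr
      _ = _ := by
          rw [Real.rpow_sub hτ0]
          field_simp
  change 1 / 2 < 1 - posteriorShrinkage π τ x
  linarith

end Prior

/-! ### Normalized risks -/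

/-- The Bayes risk per signal, i.e. divided by `m p`, of the rule with rejection region `D`. -/
def riskPerSignal (p ψ : ℝ) (D : Set ℝ) : ℝ :=
  (1 - p) / p * (gaussianReal 0 1).real D + (gaussianReal 0 (1 + ψ ^ 2).toNNReal).real Dᶜ

lemma testingRisk_eq_mul_riskPerSignal {m : ℕ} {p : ℝ} (hp0 : 0 < p) (hp1 : p < 1) (ψ : ℝ)
    {d : TestingRule m} {D : Set ℝ} (hD : MeasurableSet D) (hd : ∀ x i, d x i ↔ x i ∈ D) :
    testingRisk p ψ d = m * p * riskPerSignal p ψ D := by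
  rw [testingRisk_eq_of_region hp0 hp1 ψ hD hd, riskPerSignal]
  field_simp

lemma testingRisk_oneGroupRule {m : ℕ} {p τ K a : ℝ} {L : ℝ → ℝ} (hp0 : 0 < p) (hp1 : p < 1)
    (ψ : ℝ) (hτ : 0 < τ) [IsProbabilityMeasure (localPrior K a L)] :
    testingRisk p ψ (oneGroupRule m K a L τ) =
      m * p * riskPerSignal p ψ (rejectionRegion (localPrior K a L) τ) := by
  refine testingRisk_eq_mul_riskPerSignal hp0 hp1 ψ (measurableSet_rejectionRegion _ _)
    fun x i => ?_
  rw [oneGroupRule, postMeanKappa_eq_posteriorShrinkage hτ]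
  rfl

/-- The Bayes Oracle rejects iff `x²` exceeds this threshold. -/
def oracleThreshold (p ψ : ℝ) : ℝ :=
  (1 + ψ ^ 2) / ψ ^ 2 * Real.log ((1 + ψ ^ 2) * ((1 - p) / p) ^ 2)

lemma bayesOracle_iff {p ψ x : ℝ} (hp0 : 0 < p) (hp1 : p < 1) (hψ : 0 < ψ ^ 2) :
    gaussianPDFReal 0 (1 + ψ ^ 2).toNNReal x / gaussianPDFReal 0 1 x > (1 - p) / p ↔
      oracleThreshold p ψ < x ^ 2 := by
  set u := ψ ^ 2 with hu
  set f := (1 - p) / p with hf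
  have hf0 : 0 < f := div_pos (by linarith) hp0
  have hw : 0 < 1 + u := by linarith
  have hratio : gaussianPDFReal 0 (1 + u).toNNReal x / gaussianPDFReal 0 1 x =
      Real.exp (u / (1 + u) * x ^ 2 / 2) / √(1 + u) := by
    simp only [gaussianPDFReal, Real.coe_toNNReal _ hw.le, NNReal.coe_one, mul_one, sub_zero]
    have hexp : -x ^ 2 / (2 * (1 + u)) = u / (1 + u) * x ^ 2 / 2 + -x ^ 2 / 2 := by
      field_simp
      ring
    rw [Real.sqrt_mul (by positivity), hexp, Real.exp_add]
    field_simp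
  have hsq : 0 < √(1 + u) := Real.sqrt_pos.2 hw
  have hlog : Real.log (f * √(1 + u)) = Real.log ((1 + u) * f ^ 2) / 2 := by
    rw [Real.log_mul hf0.ne' hsq.ne', Real.log_sqrt hw.le, Real.log_mul hw.ne' (by positivity),
      Real.log_pow]
    push_cast
    ring
  rw [hratio, gt_iff_lt, lt_div_iff₀ hsq, ← Real.log_lt_iff_lt_exp (by positivity), hlog,
    oracleThreshold, ← hu, ← hf, div_lt_div_iff_of_pos_right two_pos, div_mul_eq_mul_div,
    div_mul_eq_mul_div, lt_div_iff₀ hw, div_lt_iff₀ hψ]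
  constructor <;> intro h <;> linarith

lemma testingRisk_bayesOracle {m : ℕ} {p ψ : ℝ} (hp0 : 0 < p) (hp1 : p < 1) (hψ : 0 < ψ ^ 2) :
    testingRisk p ψ (bayesOracle m p ψ) =
      m * p * riskPerSignal p ψ {x | oracleThreshold p ψ < x ^ 2} :=
  testingRisk_eq_mul_riskPerSignal hp0 hp1 ψ (measurableSet_lt (by fun_prop) (by fun_prop))
    fun _ _ => bayesOracle_iff hp0 hp1 hψ

section Asymptotics

variable {p ψ τ : ℕ → ℝ} {C c : ℝ}

lemma tendsto_div_one_add {x u : ℕ → ℝ} (hu : Tendsto u atTop atTop)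
    (h : Tendsto (fun m => x m / u m) atTop (𝓝 C)) :
    Tendsto (fun m => x m / (1 + u m)) atTop (𝓝 C) := by
  have h1 : Tendsto (fun m => 1 / u m + 1) atTop (𝓝 (0 + 1)) :=
    (hu.const_div_atTop 1).add_const 1
  have h2 := h.div h1 (by norm_num)
  simp only [zero_add, div_one] at h2
  refine h2.congr' ?_
  filter_upwards [hu.eventually_gt_atTop 0] with m hm
  simp only [Pi.div_apply]
  field_simp

lemma tendsto_log_one_div_sq_div (hp : ∀ m, 0 < p m ∧ p m < 1) (hψ : ∀ m, 0 < ψ m ^ 2)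
    (hτ : ∀ m, 0 < τ m) (hscheme : AsymptoticScheme p ψ C) (hc : 0 < c)
    (hτ_p : Tendsto (fun m => τ m / p m) atTop (𝓝 c)) :
    Tendsto (fun m => Real.log (1 / τ m ^ 2) / (1 + ψ m ^ 2)) atTop (𝓝 C) := by
  refine tendsto_div_one_add hscheme.u_tendsto ?_
  have hlogu : Tendsto (fun m => Real.log (ψ m ^ 2) / ψ m ^ 2) atTop (𝓝 0) :=
    (Real.isLittleO_log_id_atTop.tendsto_div_nhds_zero).comp hscheme.u_tendsto
  have h1 : Tendsto (fun m => -2 * Real.log (τ m / p m) - 2 * Real.log (1 - p m)) atTop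
      (𝓝 (-2 * Real.log c - 2 * Real.log (1 - 0))) :=
    ((hτ_p.log hc.ne').const_mul _).sub
      (((tendsto_const_nhds.sub hscheme.p_tendsto).log (by norm_num)).const_mul _)
  have h := (hscheme.log_v_div_u_tendsto.sub hlogu).add (h1.div_atTop hscheme.u_tendsto)
  rw [sub_zero, add_zero] at h
  refine h.congr fun m => ?_
  obtain ⟨hp0, hp1⟩ := hp m
  have hu := hψ m
  have h1p : 0 < 1 - p m := by linarith
  rw [log_one_div_sq, Real.log_mul hu.ne' (by positivity),
    Real.log_pow (n := 2) ((1 - p m) / p m), Real.log_div h1p.ne' hp0.ne',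
    Real.log_div (hτ m).ne' hp0.ne', ← sub_div, ← add_div]
  push_cast
  ring

lemma tendsto_oracleThreshold_div (hp : ∀ m, 0 < p m ∧ p m < 1) (hψ : ∀ m, 0 < ψ m ^ 2)
    (hscheme : AsymptoticScheme p ψ C) :
    Tendsto (fun m => oracleThreshold (p m) (ψ m) / (1 + ψ m ^ 2)) atTop (𝓝 C) := by
  have h1 : Tendsto (fun m => Real.log (1 + 1 / ψ m ^ 2)) atTop (𝓝 (Real.log (1 + 0))) :=
    ((hscheme.u_tendsto.const_div_atTop 1).const_add 1).log (by norm_num)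
  have h := hscheme.log_v_div_u_tendsto.add (h1.div_atTop hscheme.u_tendsto)
  rw [add_zero] at h
  refine h.congr fun m => ?_
  obtain ⟨hp0, hp1⟩ := hp m
  have hu := hψ m
  have h1p : 0 < 1 - p m := by linarith
  rw [← add_div, ← Real.log_mul (by positivity) (by positivity), oracleThreshold]
  have e : ψ m ^ 2 * ((1 - p m) / p m) ^ 2 * (1 + 1 / ψ m ^ 2) =
      (1 + ψ m ^ 2) * ((1 - p m) / p m) ^ 2 := by
    rw [mul_right_comm, mul_add, mul_one, mul_one_div_cancel hu.ne', add_comm]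
  rw [e]
  field_simp

/-- The type I contribution is at most `2 / √(1 + ψ²)`, because the threshold `s` of the oracle
satisfies `exp (-s / 2) ≤ p / ((1 - p) √(1 + ψ²))`. -/
lemma tendsto_riskPerSignal_oracle (hp : ∀ m, 0 < p m ∧ p m < 1) (hψ : ∀ m, 0 < ψ m ^ 2)
    (hscheme : AsymptoticScheme p ψ C) :
    Tendsto (fun m => riskPerSignal (p m) (ψ m) {x | oracleThreshold (p m) (ψ m) < x ^ 2}) atTop
      (𝓝 (chiSqCDF C)) := by
  have hlim := tendsto_oracleThreshold_div hp hψ hscheme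
  have hthr : ∀ᶠ m in atTop, 1 ≤ oracleThreshold (p m) (ψ m) ∧
      Real.log ((1 + ψ m ^ 2) * ((1 - p m) / p m) ^ 2) ≤ oracleThreshold (p m) (ψ m) := by
    filter_upwards [(Real.tendsto_log_atTop.comp hscheme.v_tendsto).eventually_ge_atTop 1]
      with m hm
    obtain ⟨hp0, hp1⟩ := hp m
    have hu := hψ m
    have h1p : 0 < 1 - p m := by linarith
    have h1 : 1 ≤ Real.log ((1 + ψ m ^ 2) * ((1 - p m) / p m) ^ 2) := by
      refine hm.trans (Real.log_le_log (by positivity) ?_)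
      exact mul_le_mul_of_nonneg_right (by linarith) (sq_nonneg _)
    have h2 : Real.log ((1 + ψ m ^ 2) * ((1 - p m) / p m) ^ 2) ≤
        oracleThreshold (p m) (ψ m) := by
      refine le_mul_of_one_le_left (by linarith) ?_
      rw [one_le_div hu]
      linarith
    exact ⟨h1.trans h2, h2⟩
  have hII : Tendsto (fun m => (gaussianReal 0 (1 + ψ m ^ 2).toNNReal).real
      {x | oracleThreshold (p m) (ψ m) < x ^ 2}ᶜ) atTop (𝓝 (chiSqCDF C)) := by
    refine ((continuous_chiSqCDF.tendsto C).comp hlim).congr' ?_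
    filter_upwards [hthr] with m hm
    have hu := hψ m
    have e : {x : ℝ | oracleThreshold (p m) (ψ m) < x ^ 2}ᶜ =
        {x | x ^ 2 ≤ oracleThreshold (p m) (ψ m)} := by
      ext x
      simp
    rw [e, gaussianReal_toNNReal_sq_le (by linarith) (by linarith [hm.1])]
    rfl
  have hI : Tendsto (fun m => (1 - p m) / p m *
      (gaussianReal 0 1).real {x | oracleThreshold (p m) (ψ m) < x ^ 2}) atTop (𝓝 0) := by
    have hsqrt : Tendsto (fun m => 2 / √(1 + ψ m ^ 2)) atTop (𝓝 0) :=
      (Real.tendsto_sqrt_atTop.comp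
        (tendsto_atTop_add_const_left _ 1 hscheme.u_tendsto)).const_div_atTop 2
    refine squeeze_zero' (Eventually.of_forall fun m => ?_) ?_ hsqrt
    · obtain ⟨hp0, hp1⟩ := hp m
      exact mul_nonneg (div_nonneg (by linarith) hp0.le) measureReal_nonneg
    · filter_upwards [hthr] with m ⟨h1, h2⟩
      obtain ⟨hp0, hp1⟩ := hp m
      have hf : 0 < (1 - p m) / p m := div_pos (by linarith) hp0
      set f := (1 - p m) / p m
      have hu : 0 < 1 + ψ m ^ 2 := by linarith [hψ m]
      set s := oracleThreshold (p m) (ψ m)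
      have h3 : Real.exp (-s / 2) ≤ (√(1 + ψ m ^ 2) * f)⁻¹ := by
        rw [← Real.log_le_log_iff (Real.exp_pos _) (by positivity), Real.log_exp, Real.log_inv,
          Real.log_mul (by positivity) hf.ne', Real.log_sqrt hu.le]
        rw [Real.log_mul hu.ne' (by positivity), Real.log_pow] at h2
        push_cast at h2
        linarith
      calc _ ≤ f * (2 * (Real.exp (-s / 2) / √s)) := by
            gcongr
            exact gaussianReal_lt_sq_le (by linarith)
        _ ≤ f * (2 * ((√(1 + ψ m ^ 2) * f)⁻¹ / 1)) := by
            gcongr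
            exact Real.one_le_sqrt.2 h1
        _ = _ := by field_simp
  simpa [riskPerSignal] using hI.add hII

variable {K a : ℝ} {L : ℝ → ℝ}

/-- Type II errors alone give the lower bound, as all observations with `x² ≤ B log (1 / τ²)` are
accepted for every `B < 2 a`. -/
lemma eventually_lt_riskPerSignal_rejectionRegion (hp : ∀ m, 0 < p m ∧ p m < 1)
    (hψ : ∀ m, 0 < ψ m ^ 2) (hτ : ∀ m, 0 < τ m) (hscheme : AsymptoticScheme p ψ C)
    (hτ_zero : Tendsto τ atTop (𝓝 0)) (hc : 0 < c)
    (hτ_p : Tendsto (fun m => τ m / p m) atTop (𝓝 c)) (hK : 0 < K) (hL : IsSlowlyVarying L)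
    [IsProbabilityMeasure (localPrior K a L)] (ha0 : 0 < a) (ha1 : a < 1) {r : ℝ}
    (hr : r < chiSqCDF (2 * a * C)) :
    ∀ᶠ m in atTop, r <
      riskPerSignal (p m) (ψ m) (rejectionRegion (localPrior K a L) (τ m)) := by
  have hC := hscheme.C_pos
  have hτ' : Tendsto τ atTop (𝓝[>] 0) :=
    tendsto_nhdsWithin_iff.2 ⟨hτ_zero, Eventually.of_forall hτ⟩
  have hℓ := tendsto_log_one_div_sq_div hp hψ hτ hscheme hc hτ_p
  obtain ⟨B, ⟨hB0, hBa⟩, hB⟩ : ∃ B, (0 < B ∧ B < 2 * a) ∧ r < chiSqCDF (B * C) := by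
    have hcont : Continuous fun B => chiSqCDF (B * C) :=
      continuous_chiSqCDF.comp (continuous_id.mul continuous_const)
    have h1 : ∀ᶠ B in 𝓝[<] (2 * a), r < chiSqCDF (B * C) :=
      ((hcont.tendsto (2 * a)).mono_left nhdsWithin_le_nhds).eventually (lt_mem_nhds hr)
    have h2 : ∀ᶠ B in 𝓝[<] (2 * a), 0 < B ∧ B < 2 * a := Ioo_mem_nhdsLT (by linarith)
    exact (h2.and h1).exists
  have hlim : Tendsto (fun m => chiSqCDF (B * (Real.log (1 / τ m ^ 2) / (1 + ψ m ^ 2)))) atTop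
      (𝓝 (chiSqCDF (B * C))) := (continuous_chiSqCDF.tendsto _).comp (hℓ.const_mul B)
  filter_upwards [hlim.eventually (lt_mem_nhds hB),
    hτ'.eventually (eventually_subset_compl_rejectionRegion hK hL ha0 ha1 hBa),
    (tendsto_log_one_div_sq.comp hτ').eventually_ge_atTop 0] with m h1 h2 h3
  rw [Function.comp_apply] at h3
  obtain ⟨hp0, hp1⟩ := hp m
  have h4 : 0 ≤ (1 - p m) / p m * (gaussianReal 0 1).real
      (rejectionRegion (localPrior K a L) (τ m)) :=
    mul_nonneg (div_nonneg (by linarith) hp0.le) measureReal_nonneg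
  have h5 := measureReal_mono (μ := gaussianReal 0 (1 + ψ m ^ 2).toNNReal) h2
  rw [gaussianReal_toNNReal_sq_le (by linarith [hψ m]) (mul_nonneg hB0.le h3), mul_div_assoc] at h5
  rw [riskPerSignal]
  linarith

lemma eventually_riskPerSignal_rejectionRegion_lt (hp : ∀ m, 0 < p m ∧ p m < 1)
    (hψ : ∀ m, 0 < ψ m ^ 2) (hτ : ∀ m, 0 < τ m) (hscheme : AsymptoticScheme p ψ C)
    (hτ_zero : Tendsto τ atTop (𝓝 0)) (hc : 0 < c)
    (hτ_p : Tendsto (fun m => τ m / p m) atTop (𝓝 c)) (hK : 0 < K) (hL : IsSlowlyVarying L)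
    [IsProbabilityMeasure (localPrior K a L)]
    (ha : (1 / 2 < a ∧ a < 1) ∨
      (a = 1 / 2 ∧ Tendsto (fun t => L t / √(Real.log t)) atTop (𝓝 0)))
    {ρ B r : ℝ} (hρ0 : 0 < ρ) (hρ : ρ < 1 / 2) (hB : 2 * a < ρ * B)
    (hr : chiSqCDF (B * C) < r) :
    ∀ᶠ m in atTop,
      riskPerSignal (p m) (ψ m) (rejectionRegion (localPrior K a L) (τ m)) < r := by
  have hC := hscheme.C_pos
  have ha0 : 0 < a := by rcases ha with ⟨h, -⟩ | ⟨h, -⟩ <;> linarith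
  have hB0 : 0 < B := pos_of_mul_pos_right (by linarith : 0 < ρ * B) hρ0.le
  have hτ' : Tendsto τ atTop (𝓝[>] 0) :=
    tendsto_nhdsWithin_iff.2 ⟨hτ_zero, Eventually.of_forall hτ⟩
  have hℓ := tendsto_log_one_div_sq_div hp hψ hτ hscheme hc hτ_p
  have hII : Tendsto (fun m => chiSqCDF (B * (Real.log (1 / τ m ^ 2) / (1 + ψ m ^ 2)))) atTop
      (𝓝 (chiSqCDF (B * C))) := (continuous_chiSqCDF.tendsto _).comp (hℓ.const_mul B)
  have hI := (((tendsto_gaussianReal_rejectionRegion_div hK hL ha).comp hτ').mul hτ_p).mul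
    (tendsto_const_nhds.sub hscheme.p_tendsto : Tendsto (fun m => 1 - p m) atTop (𝓝 (1 - 0)))
  have hsum := hI.add hII
  rw [zero_mul, zero_mul, zero_add] at hsum
  filter_upwards [hsum.eventually (gt_mem_nhds hr),
    hτ'.eventually (eventually_subset_rejectionRegion hK hL ha0 hρ0 hρ hB),
    (tendsto_log_one_div_sq.comp hτ').eventually_ge_atTop 0] with m h1 h2 h3
  rw [Function.comp_apply] at h3
  obtain ⟨hp0, hp1⟩ := hp m
  have hτ0 := hτ m
  have h4 : (rejectionRegion (localPrior K a L) (τ m))ᶜ ⊆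
      {x | x ^ 2 ≤ B * Real.log (1 / τ m ^ 2)} := fun x hx =>
    show x ^ 2 ≤ _ from not_lt.1 fun h => hx (h2 h)
  have h5 := measureReal_mono (μ := gaussianReal 0 (1 + ψ m ^ 2).toNNReal) h4
  rw [gaussianReal_toNNReal_sq_le (by linarith [hψ m]) (mul_nonneg hB0.le h3), mul_div_assoc] at h5
  refine lt_of_le_of_lt ?_ h1
  rw [riskPerSignal]
  refine add_le_add (le_of_eq ?_) h5
  simp only [Function.comp_apply]
  field_simp

end Asymptotics

/-- A sequence that is eventually above every number smaller than `G` is at least `G (1 + o(1))`. -/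
lemma exists_mul_one_add_le {x : ℕ → ℝ} {G : ℝ} (hG : 0 < G)
    (h : ∀ r < G, ∀ᶠ m in atTop, r < x m) :
    ∃ e : ℕ → ℝ, Tendsto e atTop (𝓝 0) ∧ ∀ m, G * (1 + e m) ≤ x m := by
  refine ⟨fun m => min (x m / G - 1) 0, ?_, fun m => ?_⟩
  · refine tendsto_order.2 ⟨fun y hy => ?_, fun y hy => ?_⟩
    · filter_upwards [h (G * (1 + y)) (by nlinarith)] with m hm
      refine lt_min ?_ hy
      rw [lt_sub_iff_add_lt, lt_div_iff₀ hG]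
      linarith
    · exact Eventually.of_forall fun m => (min_le_right _ _).trans_lt hy
  · calc _ ≤ G * (1 + (x m / G - 1)) := by
          gcongr
          exact min_le_left _ _
      _ = _ := by field_simp; ring

end

theorem theorem3p1
    (p ψ τ : ℕ → ℝ) (C c K a : ℝ) (L : ℝ → ℝ)
    (hp : ∀ m, 0 < p m ∧ p m < 1) (hψ : ∀ m, 0 < ψ m ^ 2) (hτ : ∀ m, 0 < τ m)
    (hscheme : AsymptoticScheme p ψ C)
    (hτ_zero : Tendsto τ atTop (𝓝 0))
    (hc : 0 < c) (hτ_p : Tendsto (fun m => τ m / p m) atTop (𝓝 c))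
    (hK : 0 < K) (hL : IsSlowlyVarying L)
    (hprior : IsProbabilityMeasure (localPrior K a L))
    (ha : (1 / 2 < a ∧ a < 1) ∨
      (a = 1 / 2 ∧ Tendsto (fun t => L t / √(Real.log t)) atTop (𝓝 0))) :
    -- lower bound for the Bayes risk of the induced rule
    (∃ e : ℕ → ℝ, Tendsto e atTop (𝓝 0) ∧ ∀ᶠ m : ℕ in atTop,
      m * p m * (2 * stdNormalCDF (√(2 * a * C)) - 1) * (1 + e m) ≤
        testingRisk (p m) (ψ m) (oneGroupRule m K a L (τ m))) ∧
    -- upper bound for the Bayes risk of the induced rule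
    (∀ η δ : ℝ, 0 < η → η < 1 / 2 → 0 < δ → δ < 1 →
      ∃ e : ℕ → ℝ, Tendsto e atTop (𝓝 0) ∧ ∀ᶠ m : ℕ in atTop,
        testingRisk (p m) (ψ m) (oneGroupRule m K a L (τ m)) ≤
          m * p m * (2 * stdNormalCDF (√(2 * a * C / (η * (1 - δ)))) - 1) * (1 + e m)) ∧
    -- lower bound for the ratio to the risk of the Bayes Oracle
    (∃ e : ℕ → ℝ, Tendsto e atTop (𝓝 0) ∧ ∀ᶠ m : ℕ in atTop,
      (2 * stdNormalCDF (√(2 * a * C)) - 1) / (2 * stdNormalCDF (√C) - 1) * (1 + e m) ≤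
        testingRisk (p m) (ψ m) (oneGroupRule m K a L (τ m)) /
          testingRisk (p m) (ψ m) (bayesOracle m (p m) (ψ m))) ∧
    -- upper bound for the ratio to the risk of the Bayes Oracle
    (∀ η δ : ℝ, 0 < η → η < 1 / 2 → 0 < δ → δ < 1 →
      ∃ e : ℕ → ℝ, Tendsto e atTop (𝓝 0) ∧ ∀ᶠ m : ℕ in atTop,
        testingRisk (p m) (ψ m) (oneGroupRule m K a L (τ m)) /
            testingRisk (p m) (ψ m) (bayesOracle m (p m) (ψ m)) ≤
          (2 * stdNormalCDF (√(2 * a * C / (η * (1 - δ)))) - 1) /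
            (2 * stdNormalCDF (√C) - 1) * (1 + e m)) ∧
    -- the risk is within a constant factor of the risk of the Bayes Oracle
    ((fun m : ℕ => testingRisk (p m) (ψ m) (oneGroupRule m K a L (τ m))) =O[atTop]
      fun m : ℕ => testingRisk (p m) (ψ m) (bayesOracle m (p m) (ψ m))) := by
  have hC := hscheme.C_pos
  have ha0 : 0 < a := by rcases ha with ⟨h, -⟩ | ⟨h, -⟩ <;> linarith
  have ha1 : a < 1 := by rcases ha with ⟨-, h⟩ | ⟨h, -⟩ <;> linarith
  have hR : ∀ m : ℕ, testingRisk (p m) (ψ m) (oneGroupRule m K a L (τ m)) = _ := fun m =>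
    testingRisk_oneGroupRule (hp m).1 (hp m).2 (ψ m) (hτ m)
  have hO : ∀ m : ℕ, testingRisk (p m) (ψ m) (bayesOracle m (p m) (ψ m)) = _ := fun m =>
    testingRisk_bayesOracle (hp m).1 (hp m).2 (hψ m)
  simp only [hR, hO]
  set r : ℕ → ℝ := fun m =>
    riskPerSignal (p m) (ψ m) (rejectionRegion (localPrior K a L) (τ m)) with hr
  set b : ℕ → ℝ := fun m =>
    riskPerSignal (p m) (ψ m) {x | oracleThreshold (p m) (ψ m) < x ^ 2} with hb
  have hG : 0 < chiSqCDF (2 * a * C) := chiSqCDF_pos (by positivity)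
  have hb0 : 0 < chiSqCDF C := chiSqCDF_pos hC
  have hblim : Tendsto b atTop (𝓝 (chiSqCDF C)) := tendsto_riskPerSignal_oracle hp hψ hscheme
  have hlow : ∀ y < chiSqCDF (2 * a * C), ∀ᶠ m in atTop, y < r m := fun y hy =>
    eventually_lt_riskPerSignal_rejectionRegion hp hψ hτ hscheme hτ_zero hc hτ_p hK hL ha0 ha1 hy
  -- the room between `η (1 - δ)` and `1 / 2` makes the upper bounds strict in the limit
  have hup : ∀ η δ : ℝ, 0 < η → η < 1 / 2 → 0 < δ → δ < 1 →
      ∃ y < chiSqCDF (2 * a * C / (η * (1 - δ))), ∀ᶠ m in atTop, r m < y := by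
    intro η δ hη0 hη hδ0 hδ
    have hρ0 : 0 < η * (1 - δ) := mul_pos hη0 (by linarith)
    obtain ⟨ρ, hρ1, hρ2⟩ := exists_between (by nlinarith : η * (1 - δ) < 1 / 2)
    have hρ : 0 < ρ := hρ0.trans hρ1
    obtain ⟨B, hB1, hB2⟩ := exists_between
      (div_lt_div_of_pos_left (by positivity : 0 < 2 * a) hρ0 hρ1)
    have hB0 : 0 < B := lt_trans (by positivity) hB1
    rw [div_lt_iff₀' hρ] at hB1
    have hBC : B * C < 2 * a * C / (η * (1 - δ)) := by
      rw [mul_div_right_comm]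
      gcongr
    obtain ⟨y, hy1, hy2⟩ := exists_between (chiSqCDF_lt_chiSqCDF (by positivity) hBC)
    exact ⟨y, hy2,
      eventually_riskPerSignal_rejectionRegion_lt hp hψ hτ hscheme hτ_zero hc hτ_p hK hL ha hρ hρ2
        hB1 hy1⟩
  have hratio : ∀ᶠ m : ℕ in atTop, m * p m * r m / (m * p m * b m) = r m / b m := by
    filter_upwards [eventually_gt_atTop 0] with m hm
    have : (0 : ℝ) < m := Nat.cast_pos.2 hm
    exact mul_div_mul_left _ _ (mul_pos this (hp m).1).ne'
  have hupdiv : ∀ y z : ℝ, y < z → (∀ᶠ m in atTop, r m < y) →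
      ∀ᶠ m in atTop, 0 < b m ∧ r m / b m ≤ z / chiSqCDF C := by
    intro y z hyz hy
    have h1 : Tendsto (fun m => y / b m) atTop (𝓝 (y / chiSqCDF C)) :=
      tendsto_const_nhds.div hblim hb0.ne'
    filter_upwards [hy, hblim.eventually (lt_mem_nhds hb0),
      h1.eventually (gt_mem_nhds (div_lt_div_of_pos_right hyz hb0))] with m h2 h3 h4
    exact ⟨h3, (div_le_div_of_nonneg_right h2.le h3.le).trans h4.le⟩
  refine ⟨?_, fun η δ hη0 hη hδ0 hδ => ?_, ?_, fun η δ hη0 hη hδ0 hδ => ?_, ?_⟩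
  · obtain ⟨e, he, hle⟩ := exists_mul_one_add_le hG hlow
    refine ⟨e, he, Eventually.of_forall fun m => ?_⟩
    rw [mul_assoc]
    exact mul_le_mul_of_nonneg_left (hle m) (mul_nonneg m.cast_nonneg (hp m).1.le)
  · obtain ⟨y, hy1, hy2⟩ := hup η δ hη0 hη hδ0 hδ
    refine ⟨0, tendsto_const_nhds, ?_⟩
    filter_upwards [hy2] with m hm
    rw [Pi.zero_apply, add_zero, mul_one]
    exact mul_le_mul_of_nonneg_left (hm.trans hy1).le (mul_nonneg m.cast_nonneg (hp m).1.le)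
  · have hlowdiv : ∀ y < chiSqCDF (2 * a * C) / chiSqCDF C, ∀ᶠ m in atTop, y < r m / b m := by
      intro y hy
      rw [lt_div_iff₀ hb0] at hy
      obtain ⟨z, hz1, hz2⟩ := exists_between hy
      filter_upwards [hlow z hz2, hblim.eventually (lt_mem_nhds hb0),
        (hblim.const_mul y).eventually (gt_mem_nhds hz1)] with m h1 h2 h3
      rw [lt_div_iff₀ h2]
      exact h3.trans h1
    obtain ⟨e, he, hle⟩ := exists_mul_one_add_le (div_pos hG hb0) hlowdiv
    refine ⟨e, he, ?_⟩
    filter_upwards [hratio] with m hm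
    rw [hm]
    exact hle m
  · obtain ⟨y, hy1, hy2⟩ := hup η δ hη0 hη hδ0 hδ
    refine ⟨0, tendsto_const_nhds, ?_⟩
    filter_upwards [hratio, hupdiv y _ hy1 hy2] with m h1 h2
    rw [h1, Pi.zero_apply, add_zero, mul_one]
    exact h2.2
  · obtain ⟨y, hy1, hy2⟩ := hup (1 / 4) (1 / 2) (by norm_num) (by norm_num) (by norm_num)
      (by norm_num)
    refine Asymptotics.IsBigO.of_bound (chiSqCDF (2 * a * C / (1 / 4 * (1 - 1 / 2))) / chiSqCDF C) ?_
    filter_upwards [hupdiv y _ hy1 hy2, hlow 0 hG] with m ⟨h1, h2⟩ h3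
    have h4 : (0 : ℝ) ≤ m * p m := mul_nonneg m.cast_nonneg (hp m).1.le
    rw [Real.norm_of_nonneg (by positivity), Real.norm_of_nonneg (by positivity)]
    rw [div_le_iff₀ h1] at h2
    calc _ ≤ m * p m * (chiSqCDF (2 * a * C / (1 / 4 * (1 - 1 / 2))) / chiSqCDF C * b m) := by
          gcongr
      _ = _ := by ring
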